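/- A \emph{grounded unit-length segment} over a horizontal line $\ell$ is a closed segment of length $1$ in the plane with one endpoint (its ground endpoint) on $\ell$ and the other endpoint strictly above $\ell$. The intersection graph $G(S)$ of a finite family $S=(s_1,\dots,s_n)$ of segments has vertices $1,\dots,n$, and distinct $i,j$ are adjacent if and only if $s_i\cap s_j\neq\emptyset$. \textbf{Theorem.} (i) There are a single real-RAM program and a polynomial $q$ such that for every horizontal line $\ell$, every $n\ge 0$ and every family $S$ of $n$ grounded unit-length segments over $\ell$, given by the real coordinates of their ground and free endpoints, the program halts after at most $q(n)$ steps and outputs (as a $0/1$ indicator vector) a maximum clique of $G(S)$. Here a real RAM has natural-number cells (addition, truncated subtraction, comparison, use as addresses) and real cells (rational constants, the four exact field operations with $x/0=0$, comparison; no rounding and no conversion of reals to integers), and each operation, comparison and memory access takes one step. (ii) Moreover, let $s_a,s_b\in S$ be an intersecting pair, and let $G(s_a,s_b)$ be the subgraph of $G(S)$ induced by the segments (including $s_a$ and $s_b$) that intersect both $s_a$ and $s_b$ and whose ground endpoints lie between those of $s_a$ and $s_b$ (inclusively). Then every linear ordering of the vertices of $G(s_a,s_b)$ in which the ground endpoints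 appear from left to right (ties broken arbitrarily) is umbrella-free: whenever $u,v,w$ appear in this order and $u,w$ are adjacent, $v$ is adjacent to $u$ or to $w$. Furthermore, $G(s_a,s_b)$ is a cocomparability graph, i.e. its complement has a transitive orientation. -/

import Mathlib

/-! ### A real RAM

The memory consists of arrays of natural numbers (used for counters and addresses) and arrays of
real numbers.  A program mentions only finitely many arrays, each of them unbounded, and cells are
addressed indirectly by computed natural numbers.  Reals are handled exactly; the operations on them
are the four field operations and comparison (no rounding, no conversion of a real to an integer, no
real constants other than rationals).  Natural numbers can be added, subtracted and compared, but
not multiplied, so that unit cost is a realistic charge for them.  Every operation, memory access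
and comparison takes one step. -/

namespace RealRAM

/-- Contents of the memory: `nat a i` and `real a i` are the `i`-th cells of the `a`-th array of
natural numbers and of the `a`-th array of real numbers. -/
structure Memory where
  nat : ℕ → ℕ → ℕ
  real : ℕ → ℕ → ℝ

/-- Overwrite one natural-number cell. -/
def Memory.writeNat (m : Memory) (a i v : ℕ) : Memory where
  nat := fun b j => if b = a ∧ j = i then v else m.nat b j
  real := m.real

/-- Overwrite one real cell. -/
noncomputable def Memory.writeReal (m : Memory) (a i : ℕ) (v : ℝ) : Memory where
  nat := m.nat
  real := fun b j => if b = a ∧ j = i then v else m.real b j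

/-- Natural-number expressions. -/
inductive NatExp : Type
  | const (c : ℕ)
  | read (a : ℕ) (i : NatExp)
  | add (e f : NatExp)
  | sub (e f : NatExp)

/-- Value of a natural-number expression (subtraction is truncated at `0`). -/
def NatExp.eval (m : Memory) : NatExp → ℕ
  | .const c => c
  | .read a i => m.nat a (i.eval m)
  | .add e f => e.eval m + f.eval m
  | .sub e f => e.eval m - f.eval m

/-- Number of steps needed to evaluate a natural-number expression. -/
def NatExp.cost : NatExp → ℕ
  | .const _ => 1
  | .read _ i => i.cost + 1
  | .add e f => e.cost + f.cost + 1
  | .sub e f => e.cost + f.cost + 1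

/-- Real expressions. -/
inductive RealExp : Type
  | const (c : ℚ)
  | read (a : ℕ) (i : NatExp)
  | add (e f : RealExp)
  | sub (e f : RealExp)
  | mul (e f : RealExp)
  | div (e f : RealExp)

/-- Value of a real expression (a quotient with denominator `0` evaluates to `0`). -/
noncomputable def RealExp.eval (m : Memory) : RealExp → ℝ
  | .const c => (c : ℝ)
  | .read a i => m.real a (i.eval m)
  | .add e f => e.eval m + f.eval m
  | .sub e f => e.eval m - f.eval m
  | .mul e f => e.eval m * f.eval m
  | .div e f => e.eval m / f.eval m

/-- Number of steps needed to evaluate a real expression. -/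
def RealExp.cost : RealExp → ℕ
  | .const _ => 1
  | .read _ i => i.cost + 1
  | .add e f => e.cost + f.cost + 1
  | .sub e f => e.cost + f.cost + 1
  | .mul e f => e.cost + f.cost + 1
  | .div e f => e.cost + f.cost + 1

/-- Tests: comparisons of natural numbers or of reals, and their Boolean combinations. -/
inductive Test : Type
  | natLe (e f : NatExp)
  | realLe (e f : RealExp)
  | not (b : Test)
  | and (b c : Test)

/-- Whether a test succeeds. -/
def Test.Holds (m : Memory) : Test → Prop
  | .natLe e f => e.eval m ≤ f.eval m
  | .realLe e f => e.eval m ≤ f.eval m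
  | .not b => ¬ b.Holds m
  | .and b c => b.Holds m ∧ c.Holds m

/-- Number of steps needed to evaluate a test. -/
def Test.cost : Test → ℕ
  | .natLe e f => e.cost + f.cost + 1
  | .realLe e f => e.cost + f.cost + 1
  | .not b => b.cost + 1
  | .and b c => b.cost + c.cost + 1

/-- Programs: assignments to a cell with computed address, sequencing, branching, while loops. -/
inductive Prog : Type
  | skip
  | setNat (a : ℕ) (i e : NatExp)
  | setReal (a : ℕ) (i : NatExp) (e : RealExp)
  | seq (p q : Prog)
  | branch (b : Test) (p q : Prog)
  | loop (b : Test) (p : Prog)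

/-- `Runs p m m' t`: started on the memory `m`, the program `p` halts after exactly `t` steps
with the memory `m'`.  (Programs are deterministic, see `Runs.det`.) -/
inductive Runs : Prog → Memory → Memory → ℕ → Prop
  | skip (m : Memory) : Runs .skip m m 1
  | setNat (a : ℕ) (i e : NatExp) (m : Memory) :
      Runs (.setNat a i e) m (m.writeNat a (i.eval m) (e.eval m)) (i.cost + e.cost + 1)
  | setReal (a : ℕ) (i : NatExp) (e : RealExp) (m : Memory) :
      Runs (.setReal a i e) m (m.writeReal a (i.eval m) (e.eval m)) (i.cost + e.cost + 1)
  | seq {p q : Prog} {m m' m'' : Memory} {t t' : ℕ} :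
      Runs p m m' t → Runs q m' m'' t' → Runs (.seq p q) m m'' (t + t')
  | branch_true {b : Test} {p q : Prog} {m m' : Memory} {t : ℕ} :
      b.Holds m → Runs p m m' t → Runs (.branch b p q) m m' (b.cost + t)
  | branch_false {b : Test} {p q : Prog} {m m' : Memory} {t : ℕ} :
      ¬ b.Holds m → Runs q m m' t → Runs (.branch b p q) m m' (b.cost + t)
  | loop_done {b : Test} {p : Prog} {m : Memory} :
      ¬ b.Holds m → Runs (.loop b p) m m b.cost
  | loop_step {b : Test} {p : Prog} {m m' m'' : Memory} {t t' : ℕ} :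
      b.Holds m → Runs p m m' t → Runs (.loop b p) m' m'' t' →
      Runs (.loop b p) m m'' (b.cost + t + t')

/-- The final memory and the number of steps are determined by the program and the input. -/
theorem Runs.det {p : Prog} {m m₁ m₂ : Memory} {t₁ t₂ : ℕ}
    (h₁ : Runs p m m₁ t₁) (h₂ : Runs p m m₂ t₂) : m₁ = m₂ ∧ t₁ = t₂ := by
  induction h₁ generalizing m₂ t₂ with
  | skip => cases h₂; simp
  | setNat => cases h₂; simp
  | setReal => cases h₂; simp
  | seq _ _ ih ih' =>
    cases h₂ with
    | seq k k' =>
      obtain ⟨rfl, rfl⟩ := ih k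
      obtain ⟨rfl, rfl⟩ := ih' k'
      simp
  | branch_true hb _ ih =>
    cases h₂ with
    | branch_true _ k => obtain ⟨rfl, rfl⟩ := ih k; simp
    | branch_false hn _ => exact absurd hb hn
  | branch_false hn _ ih =>
    cases h₂ with
    | branch_true hb _ => exact absurd hb hn
    | branch_false _ k => obtain ⟨rfl, rfl⟩ := ih k; simp
  | loop_done hn =>
    cases h₂ with
    | loop_done _ => simp
    | loop_step hb _ _ => exact absurd hb hn
  | loop_step hb _ _ ih ih' =>
    cases h₂ with
    | loop_done hn => exact absurd hb hn
    | loop_step _ k k' =>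
      obtain ⟨rfl, rfl⟩ := ih k
      obtain ⟨rfl, rfl⟩ := ih' k'
      simp

end RealRAM

/-! ### Grounded unit-length segments and their intersection graphs -/

/-- A closed unit-length segment in the plane with one endpoint on the horizontal line `y = h`
(the ground line) and the other (free) endpoint strictly above that line. -/
structure GroundedUnitSegment (h : ℝ) where
  ground : EuclideanSpace ℝ (Fin 2)
  free : EuclideanSpace ℝ (Fin 2)
  ground_mem : ground 1 = h
  free_above : h < free 1
  unit_length : dist ground free = 1

namespace GroundedUnitSegment

/-- The set of points of the segment. -/
def points {h : ℝ} (s : GroundedUnitSegment h) : Set (EuclideanSpace ℝ (Fin 2)) :=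
  segment ℝ s.ground s.free

/-- Two segments intersect if they have a common point. -/
def Meets {h : ℝ} (s t : GroundedUnitSegment h) : Prop :=
  (s.points ∩ t.points).Nonempty

/-- The intersection graph of a finite family of segments. -/
def intersectionGraph {h : ℝ} {n : ℕ} (S : Fin n → GroundedUnitSegment h) :
    SimpleGraph (Fin n) where
  Adj i j := i ≠ j ∧ (S i).Meets (S j)
  symm := ⟨fun i j hij => ⟨hij.1.symm, by
    have h2 := hij.2
    unfold Meets at h2 ⊢
    rwa [Set.inter_comm]⟩⟩
  loopless := ⟨fun _ hi => hi.1 rfl⟩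

/-- The segments that lie between the `a`-th and the `b`-th segment on the ground line (these two
included) and that intersect both of them. -/
def between {h : ℝ} {n : ℕ} (S : Fin n → GroundedUnitSegment h) (a b : Fin n) : Set (Fin n) :=
  {i | (S i).ground 0 ∈ Set.uIcc ((S a).ground 0) ((S b).ground 0) ∧
    (S i).Meets (S a) ∧ (S i).Meets (S b)}

/-- The input memory: cell `0` of natural-number array `0` holds the number of segments, and the
`i`-th cells of real arrays `0, 1, 2, 3` hold the coordinates of the ground endpoint and of the free
endpoint of the `i`-th segment.  All other cells hold `0`. -/
noncomputable def inputMemory {h : ℝ} {n : ℕ} (S : Fin n → GroundedUnitSegment h) :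
    RealRAM.Memory where
  nat := fun a i => if a = 0 ∧ i = 0 then n else 0
  real := fun a i =>
    if hi : i < n then
      if a = 0 then (S ⟨i, hi⟩).ground 0
      else if a = 1 then (S ⟨i, hi⟩).ground 1
      else if a = 2 then (S ⟨i, hi⟩).free 0
      else if a = 3 then (S ⟨i, hi⟩).free 1
      else 0
    else 0

end GroundedUnitSegment

/-! ### Cocomparability graphs and umbrella-free orderings -/

/-- `G` is a cocomparability graph: the edges of its complement are the comparable pairs of a
(strict) partial order, that is, the complement has a transitive orientation. -/
def IsCocomparabilityGraph {V : Type*} (G : SimpleGraph V) : Prop :=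
  ∃ r : V → V → Prop, IsStrictOrder V r ∧ ∀ u v, Gᶜ.Adj u v ↔ r u v ∨ r v u

/-- The strict linear order `r` on the vertices is an umbrella-free ordering of `G`. -/
def IsUmbrellaFreeOrdering {V : Type*} (G : SimpleGraph V) (r : V → V → Prop) : Prop :=
  IsStrictTotalOrder V r ∧
    ∀ u v w, r u v → r v w → G.Adj u w → G.Adj u v ∨ G.Adj v w

/-! Put one segment left of another if it is grounded further left and the two are disjoint.
Segments meet exactly when neither is left of the other, so cliques are the antichains of this
relation. It is not transitive in general; the heart of the proof is that it is transitive among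
segments grounded between `a` and `b` and meeting both (`segment_trans`).

Suppose `u` is left of `v` and `v` is left of `w`, but `u` is not left of `w`. Then `u` and `w`
cross above the top of `v`. If `v` leans right, then `a`, grounded no further right than `u`, must
lean more in order to reach `v`, and by unit length it is lower than `v`. Consider the unit disc
about the ground point of `v`. The segment `w` is inside it at the height of the tip of `a`, and
again at the lower of the tops of `u` and `w`, hence by convexity also at the height of the tip of
`v`. There, however, it runs strictly to the right of that tip, which lies on the right half of the
circle. A left-leaning `v` is the mirror image, with `b` in place of `a`; a vertical `v` would have
the largest possible height. Part (ii) follows directly from this transitivity.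

For (i), every member of a nonempty clique is grounded between its leftmost and rightmost members
and meets both. So it suffices to find a maximum antichain for each pair of bounding segments. By
Dilworth's theorem this is bipartite matching on two copies of the poset. An auction builds the
matching and integer labels; at a level that no label takes, the labels cut out a vertex cover no
larger than the matching (`AuctionInv.card_le_card_levelSet`). The vertices outside the cover form a
maximum antichain. The program tries all pairs and all levels and keeps the largest candidate. -/

/-! ### Order of two grounded segments -/

/-- Two segments are described by the abscissae `x`, `x'` of the ground endpoints, the abscissae
`f`, `f'` of the free endpoints, and the heights `H`, `H'`.  The first one is to the left of the
second one on the ground line and at every height that both of them reach. -/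
def SegmentLeftOf (x f H x' f' H' : ℝ) : Prop :=
  ¬ x' ≤ x ∧ ¬ (H ≤ H' ∧ x' + (f' - x') * (H / H') ≤ f) ∧
    ¬ (H' ≤ H ∧ f' ≤ x + (f - x) * (H' / H))

/-- The quotients of heights only serve to evaluate the taller segment at the top of the lower one.
At equal heights both clauses of the definition apply and agree. -/
theorem segmentLeftOf_iff {x k H x' k' H' : ℝ} (hH : 0 < H) (hH' : 0 < H') :
    SegmentLeftOf x (x + k * H) H x' (x' + k' * H') H' ↔
      x < x' ∧ x + k * min H H' < x' + k' * min H H' := by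
  have e1 : (x' + k' * H' - x') * (H / H') = k' * H := by field_simp; ring
  have e2 : (x + k * H - x) * (H' / H) = k * H' := by field_simp; ring
  unfold SegmentLeftOf
  rw [e1, e2]
  rcases lt_trichotomy H H' with h | h | h
  · rw [min_eq_left h.le]
    simp [h.le, h.not_ge]
  · subst h
    simp
  · rw [min_eq_right h.le]
    simp [h.le, h.not_ge]

/-- This convex quadratic cannot exceed `1` between two points where it is at most `1`. -/
theorem sq_add_sq_le_one_of_between {c k y₁ y₂ y₃ : ℝ} (h₁₂ : y₁ < y₂) (h₂₃ : y₂ < y₃)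
    (h₁ : (c + k * y₁) ^ 2 + y₁ ^ 2 ≤ 1) (h₃ : (c + k * y₃) ^ 2 + y₃ ^ 2 ≤ 1) :
    (c + k * y₂) ^ 2 + y₂ ^ 2 ≤ 1 := by
  have h13 : 0 < y₃ - y₁ := by linarith
  have key : (y₃ - y₁) * ((c + k * y₂) ^ 2 + y₂ ^ 2) =
      (y₃ - y₂) * ((c + k * y₁) ^ 2 + y₁ ^ 2) + (y₂ - y₁) * ((c + k * y₃) ^ 2 + y₃ ^ 2)
        - (1 + k ^ 2) * ((y₃ - y₂) * (y₂ - y₁) * (y₃ - y₁)) := by ring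
  have p1 := mul_le_mul_of_nonneg_left h₁ (sub_pos.2 h₂₃).le
  have p2 := mul_le_mul_of_nonneg_left h₃ (sub_pos.2 h₁₂).le
  have p3 : 0 ≤ (1 + k ^ 2) * ((y₃ - y₂) * (y₂ - y₁) * (y₃ - y₁)) := by
    have := sub_pos.2 h₂₃
    have := sub_pos.2 h₁₂
    positivity
  by_contra hcon
  push Not at hcon
  have := mul_lt_mul_of_pos_left hcon h13
  linarith

/-- Comparison of two affine functions at an intermediate argument. -/
theorem affine_lt_of_lt_of_lt {x k x' k' y z : ℝ} (h0 : x < x') (hy : x + k * y < x' + k' * y)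
    (hz : 0 ≤ z) (hzy : z ≤ y) : x + k * z < x' + k' * z := by
  rcases hz.eq_or_lt with rfl | hz
  · simpa using h0
  · have hy0 : 0 < y := hz.trans_le hzy
    by_contra hcon
    push Not at hcon
    have a1 := mul_le_mul_of_nonneg_left hcon hy0.le
    have a2 := mul_lt_mul_of_pos_left hy hz
    have a3 := mul_le_mul_of_nonneg_right hzy (sub_pos.2 h0).le
    nlinarith

/-- Unit length ties the height to the inverse slope: the more a segment leans, the lower it is. -/
theorem lt_of_sq_lt_of_unit {k H k' H' : ℝ} (hH : 0 < H) (hH' : 0 < H')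
    (e : (1 + k ^ 2) * H ^ 2 = 1) (e' : (1 + k' ^ 2) * H' ^ 2 = 1) (h : k' ^ 2 < k ^ 2) :
    H < H' := by
  by_contra hcon
  push Not at hcon
  have : H' ^ 2 ≤ H ^ 2 := by gcongr
  nlinarith [sq_nonneg k, sq_pos_of_pos hH, sq_nonneg k', sq_pos_of_pos hH']

/-- The case of a segment `v` leaning to the right; the segment `a` is the witness. -/
theorem segment_trans_of_pos {xa ka Ha xu ku Hu xv kv Hv xw kw Hw : ℝ}
    (ha : 0 < Ha) (hv : 0 < Hv)
    (ea : (1 + ka ^ 2) * Ha ^ 2 = 1) (eu : (1 + ku ^ 2) * Hu ^ 2 = 1)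
    (ev : (1 + kv ^ 2) * Hv ^ 2 = 1) (ew : (1 + kw ^ 2) * Hw ^ 2 = 1)
    (hau : xa ≤ xu) (huv : xu < xv) (hvw : xv < xw)
    (hkv : 0 < kv) (hHu : Hv < Hu) (hHw : Hv < Hw)
    (nvw : xv + kv * Hv < xw + kw * Hv)
    (nav : xv + kv * min Ha Hv ≤ xa + ka * min Ha Hv)
    (naw : xw + kw * min Ha Hw ≤ xa + ka * min Ha Hw)
    (nuw : xw + kw * min Hu Hw ≤ xu + ku * min Hu Hw) : False := by
  -- Grounded further left, `a` has caught up with `v` at the lower of their tops, so it leans more.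
  have hka : kv < ka := by
    have hm : 0 < min Ha Hv := lt_min ha hv
    by_contra hcon
    push Not at hcon
    have := mul_le_mul_of_nonneg_right hcon hm.le
    linarith
  have hHa : Ha < Hv := lt_of_sq_lt_of_unit ha hv ea ev (pow_lt_pow_left₀ hka hkv.le two_ne_zero)
  rw [min_eq_left (hHa.trans hHw).le] at naw
  have c := affine_lt_of_lt_of_lt hvw nvw ha.le hHa.le
  have hkvHa : 0 < kv * Ha := mul_pos hkv ha
  -- Each of `f1`, `f2`, `f3` places a point of `w` in the unit disc about the ground point of `v`.
  -- Here the offset of `w` is squeezed between `0` and `ka * Ha`.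
  have f1 : ((xw - xv) + kw * Ha) ^ 2 + Ha ^ 2 ≤ 1 := by
    have l : 0 ≤ (xw - xv) + kw * Ha := by linarith
    have r : (xw - xv) + kw * Ha ≤ ka * Ha := by linarith
    have := pow_le_pow_left₀ l r 2
    linarith
  obtain ⟨m, hm⟩ : ∃ m, m = min Hu Hw := ⟨_, rfl⟩
  rw [← hm] at nuw
  have hmv : Hv < m := hm ▸ lt_min hHu hHw
  have m0 : 0 < m := hv.trans hmv
  have hmu : m ^ 2 ≤ Hu ^ 2 := pow_le_pow_left₀ m0.le (hm ▸ min_le_left _ _) 2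
  have hmw : m ^ 2 ≤ Hw ^ 2 := pow_le_pow_left₀ m0.le (hm ▸ min_le_right _ _) 2
  -- The offset lies between `kw * m` and `ku * m`; at height `m`, both of these stay in the disc
  -- because neither `u` nor `w` is lower than `m`.
  have f3 : ((xw - xv) + kw * m) ^ 2 + m ^ 2 ≤ 1 := by
    have l : kw * m ≤ (xw - xv) + kw * m := by linarith
    have r : (xw - xv) + kw * m ≤ ku * m := by linarith
    have b1 : (1 + ku ^ 2) * m ^ 2 ≤ 1 :=
      (mul_le_mul_of_nonneg_left hmu (by positivity)).trans eu.le
    have b2 : (1 + kw ^ 2) * m ^ 2 ≤ 1 :=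
      (mul_le_mul_of_nonneg_left hmw (by positivity)).trans ew.le
    rcases le_total 0 ((xw - xv) + kw * m) with h | h
    · have := pow_le_pow_left₀ h r 2
      linarith
    · have := pow_le_pow_left₀ (neg_nonneg.2 h) (neg_le_neg l) 2
      linarith
  have f2 := sq_add_sq_le_one_of_between hHa hmv f1 f3
  -- The tip of `v` is on the circle with positive offset, so a point strictly to its right is
  -- outside the disc.
  have p : 0 < kv * Hv := mul_pos hkv hv
  have q : kv * Hv < (xw - xv) + kw * Hv := by linarith
  have := pow_lt_pow_left₀ q p.le (n := 2) (by norm_num)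
  linarith

/-- Transitivity in terms of inverse slopes. -/
theorem segment_trans {xa ka Ha xb kb Hb xu ku Hu xv kv Hv xw kw Hw : ℝ}
    (ha : 0 < Ha) (hb : 0 < Hb) (hu : 0 < Hu) (hv : 0 < Hv) (hw : 0 < Hw)
    (ea : (1 + ka ^ 2) * Ha ^ 2 = 1) (eb : (1 + kb ^ 2) * Hb ^ 2 = 1)
    (eu : (1 + ku ^ 2) * Hu ^ 2 = 1)
    (ev : (1 + kv ^ 2) * Hv ^ 2 = 1) (ew : (1 + kw ^ 2) * Hw ^ 2 = 1)
    (hau : xa ≤ xu) (huv : xu < xv) (hvw : xv < xw) (hwb : xw ≤ xb)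
    (nuv : xu + ku * min Hu Hv < xv + kv * min Hu Hv)
    (nvw : xv + kv * min Hv Hw < xw + kw * min Hv Hw)
    (nav : xv + kv * min Ha Hv ≤ xa + ka * min Ha Hv)
    (naw : xw + kw * min Ha Hw ≤ xa + ka * min Ha Hw)
    (nvb : xb + kb * min Hv Hb ≤ xv + kv * min Hv Hb)
    (nub : xb + kb * min Hu Hb ≤ xu + ku * min Hu Hb) :
    xu + ku * min Hu Hw < xw + kw * min Hu Hw := by
  by_contra hcon
  push Not at hcon
  have hm0 : 0 < min Hu Hw := lt_min hu hw
  -- If `v` reached this height, the two comparisons with `v` could be chained there.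
  have hlt : Hv < min Hu Hw := by
    by_contra h
    push Not at h
    have h1 := affine_lt_of_lt_of_lt huv nuv hm0.le (le_min (min_le_left _ _) h)
    have h2 := affine_lt_of_lt_of_lt hvw nvw hm0.le (le_min h (min_le_right _ _))
    linarith
  obtain ⟨hHu, hHw⟩ := lt_min_iff.1 hlt
  rw [min_eq_right hHu.le] at nuv
  rw [min_eq_left hHw.le] at nvw
  rcases lt_trichotomy kv 0 with h | h | h
  -- Reflection in a vertical line swaps `u` with `w` and replaces the witness `a` by `b`.
  · refine segment_trans_of_pos (xa := -xb) (ka := -kb) (xu := -xw) (ku := -kw) (xv := -xv)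
      (kv := -kv) (xw := -xu) (kw := -ku) hb hv (by simpa using eb) (by simpa using ew)
      (by simpa using ev) (by simpa using eu) (by linarith) (by linarith) (by linarith)
      (by linarith) hHw hHu (by linarith) ?_ ?_ ?_
    · rw [min_comm]; linarith
    · rw [min_comm]; linarith
    · rw [min_comm]; linarith
  · subst h
    -- A vertical `v` has height one, which no unit segment exceeds.
    have : Hv ^ 2 < Hu ^ 2 := pow_lt_pow_left₀ hHu hv.le (by norm_num)
    nlinarith [sq_nonneg ku, sq_nonneg Hu]
  · exact segment_trans_of_pos ha hv ea eu ev ew hau huv hvw h hHu hHw nvw nav naw hcon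

/-! ### Geometry of grounded segments -/

namespace GroundedUnitSegment

variable {h : ℝ}

/-- The height of a segment. -/
noncomputable def height (s : GroundedUnitSegment h) : ℝ := s.free 1 - s.ground 1

/-- The inverse slope of a segment. -/
noncomputable def invSlope (s : GroundedUnitSegment h) : ℝ :=
  (s.free 0 - s.ground 0) / s.height

theorem height_pos (s : GroundedUnitSegment h) : 0 < s.height := by
  unfold height
  rw [s.ground_mem]
  exact sub_pos.2 s.free_above

theorem free_zero (s : GroundedUnitSegment h) :
    s.free 0 = s.ground 0 + s.invSlope * s.height := by
  have := s.height_pos.ne'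
  unfold invSlope
  field_simp
  ring

theorem free_one (s : GroundedUnitSegment h) : s.free 1 = h + s.height := by
  unfold height
  rw [s.ground_mem]
  ring

theorem unit_height (s : GroundedUnitSegment h) : (1 + s.invSlope ^ 2) * s.height ^ 2 = 1 := by
  have h1 := s.unit_length
  rw [EuclideanSpace.dist_eq, Real.sqrt_eq_one, Fin.sum_univ_two, Real.dist_eq, Real.dist_eq,
    sq_abs, sq_abs, s.free_zero, s.free_one, s.ground_mem] at h1
  linarith [h1]

theorem mem_points_iff (s : GroundedUnitSegment h) (z : EuclideanSpace ℝ (Fin 2)) :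
    z ∈ s.points ↔ ∃ y, 0 ≤ y ∧ y ≤ s.height ∧ z 0 = s.ground 0 + s.invSlope * y ∧
      z 1 = h + y := by
  have hs := s.height_pos
  unfold points
  rw [segment_eq_image']
  constructor
  · rintro ⟨θ, ⟨h0, h1⟩, rfl⟩
    refine ⟨θ * s.height, by positivity, by nlinarith, ?_, ?_⟩
    · simp [s.free_zero]; ring
    · simp [s.free_one, s.ground_mem]
  · rintro ⟨y, h0, h1, e0, e1⟩
    refine ⟨y / s.height, ⟨by positivity, (div_le_one hs).2 h1⟩, ?_⟩
    ext i
    fin_cases i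
    · simp [s.free_zero, e0]; field_simp
    · simp [s.free_one, s.ground_mem, e1]; field_simp

/-- The relation that `s` is to the left of `t` on the ground line and disjoint from `t`. -/
def LeftOf (s t : GroundedUnitSegment h) : Prop :=
  SegmentLeftOf (s.ground 0) (s.free 0) s.height (t.ground 0) (t.free 0) t.height

theorem leftOf_iff (s t : GroundedUnitSegment h) :
    s.LeftOf t ↔ s.ground 0 < t.ground 0 ∧
      s.ground 0 + s.invSlope * min s.height t.height <
        t.ground 0 + t.invSlope * min s.height t.height := by
  unfold LeftOf
  rw [s.free_zero, t.free_zero]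
  exact segmentLeftOf_iff s.height_pos t.height_pos

theorem Meets.symm {s t : GroundedUnitSegment h} (hm : s.Meets t) : t.Meets s := by
  unfold Meets at *
  rwa [Set.inter_comm]

theorem Meets.not_leftOf {s t : GroundedUnitSegment h} (hm : s.Meets t) : ¬ s.LeftOf t := by
  obtain ⟨z, hs, ht⟩ := hm
  rw [mem_points_iff] at hs ht
  obtain ⟨y, h0, h1, e0, e1⟩ := hs
  obtain ⟨y', h0', h1', e0', e1'⟩ := ht
  obtain rfl : y = y' := by linarith
  rw [leftOf_iff]
  rintro ⟨c, d⟩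
  have := affine_lt_of_lt_of_lt c d h0 (le_min h1 h1')
  linarith

/-- Either the ground points coincide, or the supporting lines change order between the ground and
the lower top, and the crossing belongs to both segments. -/
theorem meets_of_not_leftOf {s t : GroundedUnitSegment h} (hst : s.ground 0 ≤ t.ground 0)
    (hn : ¬ s.LeftOf t) : s.Meets t := by
  rcases hst.eq_or_lt with e | e
  · have hs0 := s.height_pos
    have ht0 := t.height_pos
    refine ⟨s.ground, (mem_points_iff _ _).2 ⟨0, le_rfl, hs0.le, by simp, by simp [s.ground_mem]⟩,
      (mem_points_iff _ _).2 ⟨0, le_rfl, ht0.le, by simp [e], by simp [s.ground_mem]⟩⟩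
  · rw [leftOf_iff] at hn
    push Not at hn
    have hk := hn e
    have hm0 : 0 < min s.height t.height := lt_min s.height_pos t.height_pos
    have hd : 0 < s.invSlope - t.invSlope := by
      by_contra hcon
      push Not at hcon
      nlinarith
    obtain ⟨y, hy⟩ : ∃ y, y = (t.ground 0 - s.ground 0) / (s.invSlope - t.invSlope) := ⟨_, rfl⟩
    have hy0 : 0 ≤ y := by rw [hy]; exact div_nonneg (by linarith) hd.le
    have hye : y * (s.invSlope - t.invSlope) = t.ground 0 - s.ground 0 := by
      rw [hy]; field_simp
    have hym : y ≤ min s.height t.height := by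
      rw [hy, div_le_iff₀ hd]; linarith
    refine ⟨!₂[s.ground 0 + s.invSlope * y, h + y], (mem_points_iff _ _).2
      ⟨y, hy0, hym.trans (min_le_left _ _), by simp, by simp⟩, (mem_points_iff _ _).2
      ⟨y, hy0, hym.trans (min_le_right _ _), ?_, by simp⟩⟩
    simp only [Matrix.cons_val_zero]
    linarith

theorem LeftOf.ground_lt {s t : GroundedUnitSegment h} (hst : s.LeftOf t) :
    s.ground 0 < t.ground 0 := ((leftOf_iff s t).1 hst).1

theorem meets_iff (s t : GroundedUnitSegment h) : s.Meets t ↔ ¬ s.LeftOf t ∧ ¬ t.LeftOf s := by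
  constructor
  · exact fun hm => ⟨hm.not_leftOf, hm.symm.not_leftOf⟩
  · rintro ⟨h1, h2⟩
    rcases le_total (s.ground 0) (t.ground 0) with h | h
    · exact meets_of_not_leftOf h h1
    · exact (meets_of_not_leftOf h h2).symm

/-- `LeftOf` is transitive on segments grounded between two segments that they all meet. -/
theorem LeftOf.trans_of_not_leftOf {a b u v w : GroundedUnitSegment h} (huv : u.LeftOf v)
    (hvw : v.LeftOf w) (hau : a.ground 0 ≤ u.ground 0) (hwb : w.ground 0 ≤ b.ground 0)
    (nav : ¬ a.LeftOf v) (naw : ¬ a.LeftOf w) (nub : ¬ u.LeftOf b) (nvb : ¬ v.LeftOf b) :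
    u.LeftOf w := by
  have g1 := huv.ground_lt
  have g2 := hvw.ground_lt
  rw [leftOf_iff] at *
  push Not at nav naw nub nvb
  exact ⟨g1.trans g2, segment_trans a.height_pos b.height_pos u.height_pos v.height_pos
    w.height_pos a.unit_height b.unit_height u.unit_height v.unit_height w.unit_height hau g1 g2
    hwb huv.2 hvw.2 (nav (by linarith)) (naw (by linarith)) (nvb (by linarith))
    (nub (by linarith))⟩

/-! ### Umbrella-freeness and cocomparability -/

section Between

variable {n : ℕ} {S : Fin n → GroundedUnitSegment h} {a b : Fin n}

theorem LeftOf.trans_between {u v w : Fin n} (hu : u ∈ between S a b) (hv : v ∈ between S a b)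
    (hw : w ∈ between S a b) (huv : (S u).LeftOf (S v)) (hvw : (S v).LeftOf (S w)) :
    (S u).LeftOf (S w) := by
  obtain ⟨u1, u2, u3⟩ := hu
  obtain ⟨v1, v2, v3⟩ := hv
  obtain ⟨w1, w2, w3⟩ := hw
  rcases le_total ((S a).ground 0) ((S b).ground 0) with hab | hab
  · rw [Set.uIcc_of_le hab] at u1 v1 w1
    exact huv.trans_of_not_leftOf hvw u1.1 w1.2 v2.symm.not_leftOf w2.symm.not_leftOf
      u3.not_leftOf v3.not_leftOf
  · rw [Set.uIcc_of_ge hab] at u1 v1 w1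
    exact huv.trans_of_not_leftOf hvw u1.1 w1.2 v3.symm.not_leftOf w3.symm.not_leftOf
      u2.not_leftOf v2.not_leftOf

/-- In such an ordering a non-adjacent pair is a `LeftOf` pair, so an umbrella would contradict
transitivity. -/
theorem isUmbrellaFreeOrdering_between {r : between S a b → between S a b → Prop}
    (hr : IsStrictTotalOrder (between S a b) r)
    (hg : ∀ u v, r u v → (S u).ground 0 ≤ (S v).ground 0) :
    IsUmbrellaFreeOrdering ((intersectionGraph S).induce (between S a b)) r := by
  refine ⟨hr, fun u v w huv hvw huw => ?_⟩
  by_contra hcon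
  push Not at hcon
  have aux : ∀ u v, r u v → ¬ ((intersectionGraph S).induce (between S a b)).Adj u v →
      (S u).LeftOf (S v) := by
    intro u v huv hn
    by_contra hl
    refine hn ⟨fun e => ?_, meets_of_not_leftOf (hg u v huv) hl⟩
    have e' : u = v := Subtype.ext e
    exact irrefl_of r v (e' ▸ huv)
  exact Meets.not_leftOf huw.2
    ((aux u v huv hcon.1).trans_between u.2 v.2 w.2 (aux v w hvw hcon.2))

/-- `LeftOf` itself orients the complement. -/
theorem isCocomparabilityGraph_between :
    IsCocomparabilityGraph ((intersectionGraph S).induce (between S a b)) := by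
  refine ⟨fun u v => (S u).LeftOf (S v), ?_, fun u v => ?_⟩
  · have i1 : Std.Irrefl (fun u v : between S a b => (S u).LeftOf (S v)) :=
      ⟨fun u hu => hu.ground_lt.false⟩
    have i2 : IsTrans _ (fun u v : between S a b => (S u).LeftOf (S v)) :=
      ⟨fun u v w huv hvw => huv.trans_between u.2 v.2 w.2 hvw⟩
    exact {}
  · have key : (u ≠ v ∧ ¬ ((u : Fin n) ≠ v ∧ (S u).Meets (S v))) ↔
        ((S u).LeftOf (S v) ∨ (S v).LeftOf (S u)) := by
      rw [meets_iff]
      constructor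
      · rintro ⟨h1, h2⟩
        by_contra hc
        push Not at hc
        exact h2 ⟨fun e => h1 (Subtype.ext e), hc⟩
      · rintro (h1 | h1)
        · exact ⟨fun e => (e ▸ h1).ground_lt.false, fun h2 => h2.2.1 h1⟩
        · exact ⟨fun e => (e ▸ h1).ground_lt.false, fun h2 => h2.2.2 h1⟩
    rw [← key]
    rfl

end Between

end GroundedUnitSegment

/-! ### Bipartite matching by an auction -/

/-- State of the auction on the bipartite graph `E` with `n` vertices on each side: the left vertex
`x` is unmatched if `p x = 0` and matched to `y` if `p x = y + 1`; the label of `y` is `d y`. -/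
structure AuctionInv (n : ℕ) (E : ℕ → ℕ → Prop) (p d : ℕ → ℕ) : Prop where
  edge : ∀ x < n, ∀ y, p x = y + 1 → E x y
  inj : ∀ x < n, ∀ x' < n, p x = p x' → p x ≠ 0 → x = x'
  slack : ∀ x < n, ∀ y y', p x = y + 1 → E x y' → d y ≤ d y' + 1
  matched : ∀ y < n, 0 < d y → ∃ x < n, p x = y + 1
  label_le : ∀ y < n, d y ≤ n + 2

theorem AuctionInv.init {n : ℕ} {E : ℕ → ℕ → Prop} {p d : ℕ → ℕ} (hp : ∀ x < n, p x = 0)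
    (hd : ∀ y < n, d y = 0) : AuctionInv n E p d where
  edge x hx y h := by simp [hp x hx] at h
  inj x hx x' _ _ h := absurd (hp x hx) h
  slack x hx y y' h := by simp [hp x hx] at h
  matched y hy h := by simp [hd y hy] at h
  label_le y hy := by simp [hd y hy]

/-- The unmatched left vertex `u` bids for a neighbour `v` of least label. -/
theorem AuctionInv.bid {n : ℕ} {E : ℕ → ℕ → Prop} {p d p' d' : ℕ → ℕ} (I : AuctionInv n E p d)
    (hE : ∀ x y, E x y → x < n ∧ y < n) {u v : ℕ} (huv : E u v)
    (hpu : p u = 0) (hdv : d v ≤ n + 1) (hmin : ∀ y, E u y → d v ≤ d y)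
    (hp' : ∀ x < n, p' x = if x = u then v + 1 else if p x = v + 1 then 0 else p x)
    (hd' : ∀ y < n, d' y = if y = v then d v + 1 else d y) : AuctionInv n E p' d' := by
  obtain ⟨hu, hv⟩ := hE u v huv
  have mono : ∀ y < n, d y ≤ d' y := by
    intro y hy
    rw [hd' y hy]
    split_ifs with h
    · rw [h]; omega
    · exact le_rfl
  have old : ∀ x < n, ∀ y, x ≠ u → p' x = y + 1 → p x = y + 1 ∧ y ≠ v := by
    intro x hx y hxu h
    rw [hp' x hx, if_neg hxu] at h
    split_ifs at h with h1
    exact ⟨h, fun e => h1 (e ▸ h)⟩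
  have new : p' u = v + 1 := by rw [hp' u hu, if_pos rfl]
  constructor
  · intro x hx y h
    by_cases hxu : x = u
    · subst hxu
      obtain rfl : v = y := by omega
      exact huv
    · exact I.edge x hx y (old x hx y hxu h).1
  · intro x hx x' hx' h h0
    obtain ⟨y, hy⟩ := Nat.exists_eq_succ_of_ne_zero h0
    have hy' : p' x' = y + 1 := h ▸ hy
    by_cases hxu : x = u
    · by_cases hxu' : x' = u
      · rw [hxu, hxu']
      · have := (old x' hx' y hxu' hy').2
        subst hxu
        omega
    · have h1 := old x hx y hxu hy
      by_cases hxu' : x' = u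
      · subst hxu'
        omega
      · have h2 := old x' hx' y hxu' hy'
        exact I.inj x hx x' hx' (by rw [h1.1, h2.1]) (by rw [h1.1]; omega)
  · intro x hx y y' h hy'
    have hy'n := (hE x y' hy').2
    have m := mono y' hy'n
    by_cases hxu : x = u
    · subst hxu
      obtain rfl : v = y := by omega
      -- The label of `v` was least among the neighbours of the bidder, so raising it by one uses up
      -- exactly the allowed slack.
      have := hmin y' hy'
      rw [hd' v hv, if_pos rfl]
      omega
    · obtain ⟨h1, h2⟩ := old x hx y hxu h
      have h3 := I.slack x hx y y' h1 hy'
      rw [hd' y (hE x y (I.edge x hx y h1)).2, if_neg h2]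
      omega
  · intro y hy h
    by_cases hyv : y = v
    · exact ⟨u, hu, by rw [hyv]; exact new⟩
    · rw [hd' y hy, if_neg hyv] at h
      obtain ⟨x, hx, hxy⟩ := I.matched y hy h
      refine ⟨x, hx, ?_⟩
      -- The partner of `y` is neither the bidder, who was unmatched, nor the evicted partner of
      -- `v`.
      rw [hp' x hx, if_neg (fun e => by subst e; omega), if_neg (by omega), hxy]
  · intro y hy
    rw [hd' y hy]
    split_ifs with h
    · omega
    · exact I.label_le y hy

/-- Each bid decreases the potential. -/
theorem sum_label_bid {n : ℕ} {d d' : ℕ → ℕ} {v : ℕ} (hv : v < n)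
    (hdv : d v ≤ n + 1) (hd' : ∀ y < n, d' y = if y = v then d v + 1 else d y) :
    ∑ y ∈ Finset.range n, (n + 2 - d' y) < ∑ y ∈ Finset.range n, (n + 2 - d y) := by
  refine Finset.sum_lt_sum (fun y hy => ?_) ⟨v, Finset.mem_range.2 hv, ?_⟩
  · rw [hd' y (Finset.mem_range.1 hy)]
    split_ifs with h
    · subst h; omega
    · exact le_rfl
  · rw [hd' v hv, if_pos rfl]
    omega

/-- The candidate for a maximum independent set at level `l`. -/
def LevelSet (V : ℕ → Prop) (p d : ℕ → ℕ) (l i : ℕ) : Prop :=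
  V i ∧ d i < l ∧ ¬ (1 ≤ p i ∧ d (p i - 1) ≤ l)

/-- On an edge from `i` to `j`, an unmatched `i` forces `j` to have the top label, above `l`. For a
matched `i`, the slack and `d j < l` put the label of its partner at `l` or below. Either way one
end is not in the candidate. -/
theorem AuctionInv.levelSet_independent {n : ℕ} {E : ℕ → ℕ → Prop} {p d : ℕ → ℕ}
    {V : ℕ → Prop} (I : AuctionInv n E p d) (hfin : ∀ x y, E x y → p x = 0 → n + 2 ≤ d y) {l : ℕ}
    (hl : l ≤ n + 1) {i j : ℕ} (hi : i < n) (hiV : LevelSet V p d l i) (hjV : LevelSet V p d l j) :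
    ¬ E i j := by
  intro hij
  obtain ⟨-, h1, h2⟩ := hiV
  obtain ⟨-, h3, h4⟩ := hjV
  by_cases h0 : p i = 0
  · have := hfin i j hij h0
    omega
  · obtain ⟨y, hy⟩ := Nat.exists_eq_succ_of_ne_zero h0
    refine h2 ⟨by omega, ?_⟩
    have := I.slack i hi y j hy hij
    rw [hy]
    simp only [Nat.succ_eq_add_one, Nat.add_sub_cancel]
    omega

/-- Pigeonhole: `n` labels cannot fill the levels from `1` to `n + 1`. -/
theorem exists_empty_level (n : ℕ) (d : ℕ → ℕ) :
    ∃ l < n + 1, ∀ y < n, d y ≠ l + 1 := by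
  by_contra hcon
  push Not at hcon
  have hsub : Finset.range (n + 1) ⊆ (Finset.range n).image (fun y => d y - 1) := by
    intro l hl
    obtain ⟨y, hy, e⟩ := hcon l (Finset.mem_range.1 hl)
    exact Finset.mem_image.2 ⟨y, Finset.mem_range.2 hy, by omega⟩
  have h1 := (Finset.card_le_card hsub).trans Finset.card_image_le
  simp at h1

open Classical in
/-- At an empty level, the candidate is a maximum independent set (König and Dilworth). -/
theorem AuctionInv.card_le_card_levelSet {n : ℕ} {R : ℕ → ℕ → Prop} {p d : ℕ → ℕ}
    {V : ℕ → Prop} (I : AuctionInv n (fun x y => (x < n ∧ V x) ∧ (y < n ∧ V y) ∧ R x y) p d) {l : ℕ}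
    (hl : ∀ y < n, d y ≠ l)
    (htrans : ∀ i < n, ∀ j < n, ∀ k < n, V i → V j → V k → R i j → R j k → R i k)
    {Q : Finset ℕ} (hQ : ∀ i ∈ Q, i < n ∧ V i) (hind : ∀ i ∈ Q, ∀ j ∈ Q, ¬ R i j) :
    Q.card ≤ ((Finset.range n).filter (LevelSet V p d l)).card := by
  set W := (Finset.range n).filter V with hW
  set M := (Finset.range n).filter (fun x => p x ≠ 0) with hM
  set C := (Finset.range n).filter (LevelSet V p d l) with hC
  have hQW : Q ⊆ W := fun i hi => by simpa [hW] using hQ i hi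
  have hCW : C ⊆ W := by
    intro i hi
    simp only [hC, hW, Finset.mem_filter] at hi ⊢
    exact ⟨hi.1, hi.2.1⟩
  -- König cover: a matching edge whose right end has label above `l` pays for that right end, any
  -- other edge for its left end. As no label equals `l`, this accounts for every vertex outside the
  -- candidate.
  have cover : (W \ C).card ≤ M.card := by
    have hsub : W \ C ⊆ (M.filter (fun x => l < d (p x - 1))).image (fun x => p x - 1) ∪
        M.filter (fun x => ¬ l < d (p x - 1)) := by
      intro i hi
      simp only [hC, hW, hM, Finset.mem_sdiff, Finset.mem_filter, Finset.mem_range,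
        Finset.mem_union, Finset.mem_image] at hi ⊢
      obtain ⟨⟨hi, hiV⟩, hi2⟩ := hi
      by_cases h1 : d i < l
      · right
        have h2 : 1 ≤ p i ∧ d (p i - 1) ≤ l := by
          by_contra h2
          exact hi2 ⟨hi, hiV, h1, h2⟩
        exact ⟨⟨hi, by omega⟩, by omega⟩
      · left
        have h3 : l < d i := lt_of_le_of_ne (not_lt.1 h1) (hl i hi).symm
        obtain ⟨x, hx, hxi⟩ := I.matched i hi (by omega)
        exact ⟨x, ⟨⟨hx, by omega⟩, by rw [hxi]; simpa using h3⟩, by omega⟩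
    calc (W \ C).card ≤ _ := Finset.card_le_card hsub
      _ ≤ _ := Finset.card_union_le _ _
      _ ≤ (M.filter (fun x => l < d (p x - 1))).card +
          (M.filter (fun x => ¬ l < d (p x - 1))).card :=
        Nat.add_le_add_right Finset.card_image_le _
      _ = M.card := Finset.card_filter_add_card_filter_not _
  -- Weak duality: a matching edge is charged to its right end if its left end is in `Q` or above a
  -- member of `Q`, and to its left end otherwise. By transitivity the charged ends avoid `Q` and
  -- are distinct.
  have weak : M.card ≤ (W \ Q).card := by
    set A := M.filter (fun x => ∃ q ∈ Q, q = x ∨ R q x) with hA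
    set B := M.filter (fun x => ¬ ∃ q ∈ Q, q = x ∨ R q x) with hB
    have hAB : A.card + B.card = M.card := Finset.card_filter_add_card_filter_not _
    have hE : ∀ x ∈ M, (x < n ∧ V x) ∧ (p x - 1 < n ∧ V (p x - 1)) ∧ R x (p x - 1) := by
      intro x hx
      simp only [hM, Finset.mem_filter, Finset.mem_range] at hx
      exact I.edge x hx.1 (p x - 1) (by omega)
    have hinj : Set.InjOn (fun x => p x - 1) (A : Set ℕ) := by
      intro x hx x' hx' e
      simp only [hA, hM, Finset.coe_filter, Finset.mem_filter, Finset.mem_range,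
        Set.mem_ofPred_eq] at hx hx' e
      exact I.inj x hx.1.1 x' hx'.1.1 (by omega) hx.1.2
    have hdisj : Disjoint (A.image (fun x => p x - 1)) B := by
      rw [Finset.disjoint_left]
      intro y hy hyB
      obtain ⟨x, hx, rfl⟩ := Finset.mem_image.1 hy
      obtain ⟨hxM, q, hq, hqx⟩ := Finset.mem_filter.1 hx
      obtain ⟨e1, e2, e3⟩ := hE x hxM
      refine (Finset.mem_filter.1 hyB).2 ⟨q, hq, Or.inr ?_⟩
      rcases hqx with rfl | hqx
      · exact e3
      · exact htrans q (hQ q hq).1 x e1.1 _ e2.1 (hQ q hq).2 e1.2 e2.2 hqx e3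
    rw [← hAB, ← Finset.card_image_of_injOn hinj, ← Finset.card_union_of_disjoint hdisj]
    refine Finset.card_le_card fun y hy => ?_
    rcases Finset.mem_union.1 hy with hy | hy
    · obtain ⟨x, hx, rfl⟩ := Finset.mem_image.1 hy
      obtain ⟨hxM, q, hq, hqx⟩ := Finset.mem_filter.1 hx
      obtain ⟨e1, e2, e3⟩ := hE x hxM
      refine Finset.mem_sdiff.2 ⟨by simpa [hW] using e2, fun hyQ => hind q hq _ hyQ ?_⟩
      rcases hqx with rfl | hqx
      · exact e3
      · exact htrans q (hQ q hq).1 x e1.1 _ e2.1 (hQ q hq).2 e1.2 e2.2 hqx e3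
    · obtain ⟨hyM, hyQ⟩ := Finset.mem_filter.1 hy
      exact Finset.mem_sdiff.2 ⟨by simpa [hW] using (hE y hyM).1, fun h => hyQ ⟨y, h, Or.inl rfl⟩⟩
  have c1 := Finset.card_sdiff_add_card_eq_card hQW
  have c2 := Finset.card_sdiff_add_card_eq_card hCW
  omega

/-! ### Verification of real-RAM programs -/

namespace RealRAM

/-- A bound on the running time of a program in which every loop, whenever it is entered, makes at
most `B` iterations. -/
def Prog.bound (B : ℕ) : Prog → ℕ
  | .skip => 1
  | .setNat _ i e => i.cost + e.cost + 1
  | .setReal _ i e => i.cost + e.cost + 1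
  | .seq p q => p.bound B + q.bound B
  | .branch b p q => b.cost + (p.bound B + q.bound B)
  | .loop b p => B * (b.cost + p.bound B) + b.cost

/-- The bound uses only sums and products, both branches of a test being added, so it is polynomial
in `B`. -/
theorem Prog.exists_bound_eq_eval (p : Prog) :
    ∃ q : Polynomial ℕ, ∀ B, p.bound B = q.eval B := by
  induction p with
  | skip => exact ⟨1, fun B => by simp [Prog.bound]⟩
  | setNat a i e => exact ⟨Polynomial.C (i.cost + e.cost + 1), fun B => by simp [Prog.bound]⟩
  | setReal a i e => exact ⟨Polynomial.C (i.cost + e.cost + 1), fun B => by simp [Prog.bound]⟩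
  | seq p q ihp ihq =>
    obtain ⟨f, hf⟩ := ihp
    obtain ⟨g, hg⟩ := ihq
    exact ⟨f + g, fun B => by simp [Prog.bound, hf, hg]⟩
  | branch b p q ihp ihq =>
    obtain ⟨f, hf⟩ := ihp
    obtain ⟨g, hg⟩ := ihq
    exact ⟨Polynomial.C b.cost + (f + g), fun B => by simp [Prog.bound, hf, hg]⟩
  | loop b p ih =>
    obtain ⟨f, hf⟩ := ih
    exact ⟨Polynomial.X * (Polynomial.C b.cost + f) + Polynomial.C b.cost,
      fun B => by simp [Prog.bound, hf]⟩

/-- Started on `m`, the program halts within its time bound in a memory that satisfies `Q`. -/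
def WP (B : ℕ) (p : Prog) (Q : Memory → Prop) (m : Memory) : Prop :=
  ∃ m' t, Runs p m m' t ∧ t ≤ p.bound B ∧ Q m'

namespace WP

variable {B : ℕ} {p q : Prog} {Q Q' : Memory → Prop} {m : Memory}

theorem mono (h : WP B p Q m) (hQ : ∀ m', Q m' → Q' m') : WP B p Q' m := by
  obtain ⟨m', t, h1, h2, h3⟩ := h
  exact ⟨m', t, h1, h2, hQ m' h3⟩

theorem skip (h : Q m) : WP B .skip Q m := ⟨m, 1, .skip m, le_rfl, h⟩

theorem setNat {a : ℕ} {i e : NatExp} (h : Q (m.writeNat a (i.eval m) (e.eval m))) :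
    WP B (.setNat a i e) Q m :=
  ⟨_, _, .setNat a i e m, le_rfl, h⟩

theorem seq (h : WP B p (WP B q Q) m) : WP B (.seq p q) Q m := by
  obtain ⟨m', t, h1, h2, m'', t', h3, h4, h5⟩ := h
  exact ⟨m'', t + t', .seq h1 h3, Nat.add_le_add h2 h4, h5⟩

theorem branch {b : Test} (h : b.Holds m → WP B p Q m) (h' : ¬ b.Holds m → WP B q Q m) :
    WP B (.branch b p q) Q m := by
  by_cases hb : b.Holds m
  · obtain ⟨m', t, h1, h2, h3⟩ := h hb
    exact ⟨m', _, .branch_true hb h1, by simp only [Prog.bound]; omega, h3⟩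
  · obtain ⟨m', t, h1, h2, h3⟩ := h' hb
    exact ⟨m', _, .branch_false hb h1, by simp only [Prog.bound]; omega, h3⟩

/-- `I` is the invariant; the variant `V` strictly decreases, so its initial value bounds the number
of rounds. -/
theorem loop {b : Test} (I : Memory → Prop) (V : Memory → ℕ) (hV : V m ≤ B) (hI : I m)
    (step : ∀ m, I m → b.Holds m → WP B p (fun m' => I m' ∧ V m' < V m) m)
    (fin : ∀ m, I m → ¬ b.Holds m → Q m) : WP B (.loop b p) Q m := by
  have key : ∀ v m, V m ≤ v → I m →
      ∃ m' t, Runs (.loop b p) m m' t ∧ t ≤ v * (b.cost + p.bound B) + b.cost ∧ Q m' := by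
    intro v
    induction v with
    | zero =>
      intro m hv hm
      by_cases hb : b.Holds m
      · obtain ⟨m', t, -, -, -, h⟩ := step m hm hb
        omega
      · exact ⟨m, _, .loop_done hb, by omega, fin m hm hb⟩
    | succ v ih =>
      intro m hv hm
      by_cases hb : b.Holds m
      · obtain ⟨m', t, h1, h2, h3, h4⟩ := step m hm hb
        obtain ⟨m'', t', h5, h6, h7⟩ := ih m' (by omega) h3
        refine ⟨m'', _, .loop_step hb h1 h5, ?_, h7⟩
        rw [Nat.succ_mul]
        omega
      · exact ⟨m, _, .loop_done hb, by omega, fin m hm hb⟩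
  obtain ⟨m', t, h1, h2, h3⟩ := key (V m) m le_rfl hI
  exact ⟨m', t, h1, h2.trans (Nat.add_le_add_right (Nat.mul_le_mul_right _ hV) _), h3⟩

end WP

/-- The first cell of a natural-number array. -/
abbrev reg (r : ℕ) : NatExp := .read r (.const 0)

/-- Assignment to the first cell of a natural-number array. -/
abbrev setReg (r : ℕ) (e : NatExp) : Prog := .setNat r (.const 0) e

/-- Execute `p` with the counter `r` running from `0` to `n + c - 1`, where `n` is the input size. -/
def forLoop (c r : ℕ) (p : Prog) : Prog :=
  .seq (setReg r (.const 0))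
    (.loop (.not (.natLe (.add (reg 0) (.const c)) (reg r)))
      (.seq p (setReg r (.add (reg r) (.const 1)))))

@[simp] theorem Memory.writeNat_real (m : Memory) (a i v : ℕ) : (m.writeNat a i v).real = m.real :=
  rfl

theorem Memory.writeNat_nat (m : Memory) (a i v b j : ℕ) :
    (m.writeNat a i v).nat b j = if b = a ∧ j = i then v else m.nat b j := rfl

@[simp] theorem Memory.writeNat_nat_self (m : Memory) (a i v : ℕ) :
    (m.writeNat a i v).nat a i = v := by simp [Memory.writeNat_nat]

theorem Memory.writeNat_nat_of_ne (m : Memory) {a b : ℕ} (i v : ℕ) (h : b ≠ a) :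
    (m.writeNat a i v).nat b = m.nat b := by
  funext j
  simp [Memory.writeNat_nat, h]

/-- The counter is part of the memory, so the invariant is demanded after the incremented counter
has been written. -/
theorem WP.forLoop {B n c r : ℕ} {p : Prog} {Q : Memory → Prop} {m : Memory}
    (I : ℕ → Memory → Prop) (hB : n + c ≤ B) (hr : 0 ≠ r) (hn : m.nat 0 0 = n)
    (hI : I 0 (m.writeNat r 0 0))
    (step : ∀ k < n + c, ∀ m, m.nat 0 0 = n → m.nat r 0 = k → I k m →
      WP B p (fun m' => m'.nat 0 0 = n ∧ m'.nat r 0 = k ∧ I (k + 1) (m'.writeNat r 0 (k + 1))) m)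
    (fin : ∀ m, m.nat 0 0 = n → I (n + c) m → Q m) : WP B (forLoop c r p) Q m := by
  refine WP.seq (WP.setNat ?_)
  refine WP.loop (fun m => m.nat 0 0 = n ∧ m.nat r 0 ≤ n + c ∧ I (m.nat r 0) m)
    (fun m => n + c - m.nat r 0) (by omega) ?_ ?_ ?_
  · refine ⟨?_, ?_, ?_⟩
    · rw [Memory.writeNat_nat_of_ne _ _ _ hr, hn]
    · simp [NatExp.eval]
    · simpa [NatExp.eval] using hI
  · rintro m ⟨h0, hle, hI⟩ hb
    simp only [Test.Holds, NatExp.eval, h0] at hb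
    refine WP.seq ((step (m.nat r 0) (by omega) m h0 rfl hI).mono ?_)
    rintro m' ⟨h0', hr', hI'⟩
    refine WP.setNat ?_
    simp only [NatExp.eval, hr', Memory.writeNat_nat_self]
    refine ⟨⟨?_, by omega, hI'⟩, by omega⟩
    rw [Memory.writeNat_nat_of_ne _ _ _ hr, h0']
  · rintro m ⟨h0, hle, hI⟩ hb
    simp only [Test.Holds, NatExp.eval, h0] at hb
    have e : m.nat r 0 = n + c := by omega
    exact fin m h0 (e ▸ hI)

/-- The memories agree except possibly in the natural-number arrays listed in `L`. -/
def EqOff (L : List ℕ) (m m' : Memory) : Prop :=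
  m'.real = m.real ∧ ∀ c, c ∉ L → m'.nat c = m.nat c

namespace EqOff

variable {L L' : List ℕ} {m m' m'' : Memory}

theorem refl (L : List ℕ) (m : Memory) : EqOff L m m := ⟨rfl, fun _ _ => rfl⟩

theorem write (h : EqOff L m m') {a : ℕ} (ha : a ∈ L) (i v : ℕ) :
    EqOff L m (m'.writeNat a i v) :=
  ⟨h.1, fun c hc => by
    rw [Memory.writeNat_nat_of_ne _ _ _ (ne_of_mem_of_not_mem ha hc).symm, h.2 c hc]⟩

theorem trans (h : EqOff L m m') (h' : EqOff L' m' m'') (hL : L' ⊆ L) : EqOff L m m'' :=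
  ⟨h'.1.trans h.1, fun c hc => (h'.2 c (fun e => hc (hL e))).trans (h.2 c hc)⟩

end EqOff

end RealRAM

/-! ### The program

Arrays of natural numbers: `0` input size, `1` best clique, `2`, `3` the bounding segments,
`4`, `5` loop counters, `6` size of the best clique, `7` matching, `8` labels, `9`, `10`, `11` the
vertices and the label of a bid, `12` level, `13` candidate, `14` size of the candidate. -/

namespace RealRAM

/-- The order of the `i`-th and the `j`-th segment stored in the memory. -/
def StoredLeftOf (ρ : ℕ → ℕ → ℝ) (i j : ℕ) : Prop :=
  SegmentLeftOf (ρ 0 i) (ρ 2 i) (ρ 3 i - ρ 1 i) (ρ 0 j) (ρ 2 j) (ρ 3 j - ρ 1 j)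

/-- The `i`-th stored segment is grounded between the `a`-th and the `b`-th one and meets both. -/
def StoredBetween (ρ : ℕ → ℕ → ℝ) (a b i : ℕ) : Prop :=
  (ρ 0 a ≤ ρ 0 i ∧ ρ 0 i ≤ ρ 0 b) ∧ ¬ StoredLeftOf ρ a i ∧ ¬ StoredLeftOf ρ i b

/-- The bipartite graph of the order on the segments between the `a`-th and the `b`-th one. -/
def StoredEdge (n : ℕ) (ρ : ℕ → ℕ → ℝ) (a b x y : ℕ) : Prop :=
  (x < n ∧ StoredBetween ρ a b x) ∧ (y < n ∧ StoredBetween ρ a b y) ∧ StoredLeftOf ρ x y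

/-- Height of a stored segment. -/
def heightExp (i : NatExp) : RealExp := .sub (.read 3 i) (.read 1 i)

/-- Whether segment `i` is to the left of segment `j`. -/
def leftOfTest (i j : NatExp) : Test :=
  .and (.not (.realLe (.read 0 j) (.read 0 i)))
    (.and
      (.not (.and (.realLe (heightExp i) (heightExp j))
        (.realLe (.add (.read 0 j) (.mul (.sub (.read 2 j) (.read 0 j))
          (.div (heightExp i) (heightExp j)))) (.read 2 i))))
      (.not (.and (.realLe (heightExp j) (heightExp i))
        (.realLe (.read 2 j) (.add (.read 0 i) (.mul (.sub (.read 2 i) (.read 0 i))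
          (.div (heightExp j) (heightExp i))))))))

/-- Whether segment `i` is between the segments `reg 2` and `reg 3`. -/
def betweenTest (i : NatExp) : Test :=
  .and (.and (.realLe (.read 0 (reg 2)) (.read 0 i)) (.realLe (.read 0 i) (.read 0 (reg 3))))
    (.and (.not (leftOfTest (reg 2) i)) (.not (leftOfTest i (reg 3))))

/-- Whether segment `reg 4` can bid for segment `reg 5` with a label below that of the bid. -/
def bidTest : Test :=
  .and (.and (.natLe (.read 7 (reg 4)) (.const 0))
      (.natLe (.add (.read 8 (reg 5)) (.const 1)) (reg 11)))
    (.and (.and (betweenTest (reg 4)) (betweenTest (reg 5))) (leftOfTest (reg 4) (reg 5)))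

/-- Find an unmatched vertex and a neighbour of least label. -/
def findBid : Prog :=
  .seq (setReg 11 (.add (reg 0) (.const 2)))
    (forLoop 0 4 (forLoop 0 5 (.branch bidTest
      (.seq (setReg 9 (reg 4)) (.seq (setReg 10 (reg 5)) (setReg 11 (.read 8 (reg 5))))) .skip)))

/-- Match the bidder, releasing the previous partner, and raise the label. -/
def placeBid : Prog :=
  .seq (forLoop 0 4 (.branch (.and (.natLe (.read 7 (reg 4)) (.add (reg 10) (.const 1)))
      (.natLe (.add (reg 10) (.const 1)) (.read 7 (reg 4))))
      (.setNat 7 (reg 4) (.const 0)) .skip))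
    (.seq (.setNat 7 (reg 9) (.add (reg 10) (.const 1)))
      (.setNat 8 (reg 10) (.add (reg 11) (.const 1))))

/-- There is a bid. -/
def hasBid : Test := .natLe (reg 11) (.add (reg 0) (.const 1))

/-- Compute a matching and labels for the segments between `reg 2` and `reg 3`. -/
def auction : Prog :=
  .seq (forLoop 0 4 (.seq (.setNat 7 (reg 4) (.const 0)) (.setNat 8 (reg 4) (.const 0))))
    (.seq (setReg 11 (.const 0))
      (.loop hasBid (.seq findBid (.branch hasBid placeBid .skip))))

/-- Whether segment `reg 4` is in the candidate at level `reg 12 + 1`. -/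
def levelTest : Test :=
  .and (betweenTest (reg 4))
    (.and (.natLe (.read 8 (reg 4)) (reg 12))
      (.not (.and (.natLe (.const 1) (.read 7 (reg 4)))
        (.natLe (.read 8 (.sub (.read 7 (reg 4)) (.const 1))) (.add (reg 12) (.const 1))))))

/-- Compute a candidate and store it if it is larger than the best clique so far. -/
def collect : Prog :=
  .seq (setReg 14 (.const 0))
    (.seq (forLoop 0 4 (.branch levelTest
        (.seq (.setNat 13 (reg 4) (.const 1)) (setReg 14 (.add (reg 14) (.const 1))))
        (.setNat 13 (reg 4) (.const 0))))
      (.branch (.natLe (reg 14) (reg 6)) .skip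
        (.seq (setReg 6 (reg 14)) (forLoop 0 4 (.setNat 1 (reg 4) (.read 13 (reg 4)))))))

/-- The program that computes a maximum clique. -/
def maxClique : Prog :=
  forLoop 0 2 (forLoop 0 3 (.seq auction (forLoop 1 12 collect)))

/-! ### Correctness of finding and placing a bid -/

theorem leftOfTest_holds (i j : NatExp) (m : Memory) :
    (leftOfTest i j).Holds m ↔ StoredLeftOf m.real (i.eval m) (j.eval m) := Iff.rfl

theorem betweenTest_holds (i : NatExp) (m : Memory) :
    (betweenTest i).Holds m ↔ StoredBetween m.real (m.nat 2 0) (m.nat 3 0) (i.eval m) := Iff.rfl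

/-- The bid stored in the memory is the best one among the pairs in `D`. -/
structure BidInv (n : ℕ) (D : ℕ → ℕ → Prop) (m : Memory) : Prop where
  valid : m.nat 11 0 ≤ n + 1 → StoredEdge n m.real (m.nat 2 0) (m.nat 3 0) (m.nat 9 0) (m.nat 10 0) ∧
    m.nat 7 (m.nat 9 0) = 0 ∧ m.nat 8 (m.nat 10 0) = m.nat 11 0
  bid_le : m.nat 11 0 ≤ n + 2
  best : ∀ x y, D x y → m.nat 7 x = 0 →
    StoredEdge n m.real (m.nat 2 0) (m.nat 3 0) x y → m.nat 11 0 ≤ n + 1 ∧ m.nat 11 0 ≤ m.nat 8 y ∨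
      n + 2 ≤ m.nat 8 y

theorem BidInv.congr {n : ℕ} {D D' : ℕ → ℕ → Prop} {m m' : Memory} (h : BidInv n D m)
    (hm : EqOff [4, 5] m m')
    (hD : ∀ x y, D' x y → StoredEdge n m.real (m.nat 2 0) (m.nat 3 0) x y → D x y) :
    BidInv n D' m' := by
  obtain ⟨h1, h2, h3⟩ := h
  have e := hm.1
  have e2 := hm.2 2 (by decide)
  have e3 := hm.2 3 (by decide)
  have e7 := hm.2 7 (by decide)
  have e8 := hm.2 8 (by decide)
  have e9 := hm.2 9 (by decide)
  have e10 := hm.2 10 (by decide)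
  have e11 := hm.2 11 (by decide)
  constructor
  · rw [e, e2, e3, e7, e8, e9, e10, e11]; exact h1
  · rw [e11]; exact h2
  · rw [e, e2, e3, e7, e8, e11]; exact fun x y hxy h0 hE => h3 x y (hD x y hxy hE) h0 hE

theorem WP.findBid {B n : ℕ} (hB : n + 1 ≤ B) {m : Memory} (hn : m.nat 0 0 = n) :
    WP B findBid (fun m' => EqOff [4, 5, 9, 10, 11] m m' ∧ BidInv n (fun _ _ => True) m') m := by
  refine WP.seq (WP.setNat ?_)
  simp only [NatExp.eval, hn]
  -- The initial bid label `n + 2`, the cap on labels, stands for the absence of a bid.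
  refine WP.forLoop (n := n) (fun k m' => EqOff [4, 5, 9, 10, 11] m m' ∧
    BidInv n (fun x _ => x < k) m') (by omega) (by decide) ?_ ?_ ?_ ?_
  · rw [Memory.writeNat_nat_of_ne _ _ _ (by decide), hn]
  · refine ⟨((EqOff.refl _ _).write (by decide) _ _).write (by decide) _ _, ?_, ?_, ?_⟩
    · rw [Memory.writeNat_nat_of_ne _ _ _ (by decide), Memory.writeNat_nat_self]
      omega
    · rw [Memory.writeNat_nat_of_ne _ _ _ (by decide), Memory.writeNat_nat_self]
    · intro x y hxy
      omega
  · rintro k hk m₁ h0 h4 ⟨hE, hI⟩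
    -- The pairs already inspected form an initial piece of the lexicographic order.
    refine WP.forLoop (n := n) (fun l m' => EqOff [4, 5, 9, 10, 11] m m' ∧ m'.nat 4 0 = k ∧
      BidInv n (fun x y => x < k ∨ x = k ∧ y < l) m') (by omega) (by decide) h0 ?_ ?_ ?_
    · refine ⟨hE.write (by decide) _ _, ?_, ?_⟩
      · rw [Memory.writeNat_nat_of_ne _ _ _ (by decide), h4]
      · refine hI.congr ((EqOff.refl _ _).write (by decide) _ _) fun x y hxy _ => ?_
        omega
    · rintro l hl m₂ h0 h5 ⟨hE, h4, hI⟩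
      refine WP.branch (fun hb => ?_) (fun hb => ?_)
      · simp only [bidTest, Test.Holds, leftOfTest_holds, betweenTest_holds, NatExp.eval, h4,
          h5] at hb
        obtain ⟨⟨hb1, hb2⟩, ⟨hb3, hb4⟩, hb5⟩ := hb
        obtain ⟨i1, i2, i3⟩ := hI
        refine WP.seq (WP.setNat (WP.seq (WP.setNat (WP.setNat ?_))))
        simp only [NatExp.eval]
        simp [Memory.writeNat_nat, h4, h5, h0]
        refine ⟨?_, ?_, ?_, ?_⟩
        · exact (((hE.write (by decide) _ _).write (by decide) _ _).write (by decide) _ _).write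
            (by decide) _ _
        · simp [Memory.writeNat_nat]
          exact fun _ => ⟨⟨⟨by omega, hb3⟩, ⟨by omega, hb4⟩, hb5⟩, by omega⟩
        · simp [Memory.writeNat_nat]
          omega
        · simp [Memory.writeNat_nat]
          intro x y hxy hp hxyE
          by_cases hy : x = k ∧ y = l
          · rw [hy.2]; omega
          · rcases i3 x y (by omega) hp hxyE with h | h <;> omega
      · refine WP.skip ⟨h0, h5, hE.write (by decide) _ _, ?_, ?_⟩
        · rw [Memory.writeNat_nat_of_ne _ _ _ (by decide), h4]
        · obtain ⟨i1, i2, i3⟩ := hI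
          simp only [bidTest, Test.Holds, leftOfTest_holds, betweenTest_holds, NatExp.eval, h4,
            h5] at hb
          refine BidInv.congr (D := fun x y => x < k ∨ x = k ∧ y < l + 1) ⟨i1, i2, ?_⟩
            ((EqOff.refl _ _).write (by decide) _ _) fun x y hxy _ => hxy
          intro x y hxy hp hxyE
          by_cases hy : x = k ∧ y = l
          · obtain ⟨rfl, rfl⟩ := hy
            obtain ⟨⟨-, q1⟩, ⟨-, q2⟩, q3⟩ := hxyE
            have : ¬ m₂.nat 8 y + 1 ≤ m₂.nat 11 0 := fun q4 =>
              hb ⟨⟨hp.le, q4⟩, ⟨q1, q2⟩, q3⟩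
            omega
          · exact i3 x y (by omega) hp hxyE
    · rintro m₂ h0 ⟨hE, h4, hI⟩
      refine ⟨h0, h4, hE.write (by decide) _ _, hI.congr ((EqOff.refl _ _).write (by decide) _ _) ?_⟩
      rintro x y hxy ⟨-, ⟨hy, -⟩, -⟩
      omega
  · rintro m₁ h0 ⟨hE, hI⟩
    refine ⟨hE, hI.congr (EqOff.refl _ _) ?_⟩
    rintro x y - ⟨⟨hx, -⟩, -⟩
    omega

theorem WP.placeBid {B n : ℕ} (hB : n + 1 ≤ B) {m : Memory} (hn : m.nat 0 0 = n) :
    WP B placeBid (fun m' => EqOff [4, 7, 8] m m' ∧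
      (∀ x < n, m'.nat 7 x = if x = m.nat 9 0 then m.nat 10 0 + 1 else
        if m.nat 7 x = m.nat 10 0 + 1 then 0 else m.nat 7 x) ∧
      ∀ y < n, m'.nat 8 y = if y = m.nat 10 0 then m.nat 11 0 + 1 else m.nat 8 y) m := by
  refine WP.seq ?_
  refine WP.forLoop (n := n) (fun k m' => EqOff [4, 7] m m' ∧ ∀ x, m'.nat 7 x =
    if x < k ∧ m.nat 7 x = m.nat 10 0 + 1 then 0 else m.nat 7 x)
    (by omega) (by decide) hn ?_ ?_ ?_
  · refine ⟨(EqOff.refl _ _).write (by decide) _ _, fun x => ?_⟩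
    simp [Memory.writeNat_nat]
  · rintro k hk m₁ h0 h4 ⟨hE, hI⟩
    have e10 := hE.2 10 (by decide)
    have hk7 := hI k
    simp only [lt_irrefl, false_and, if_false] at hk7
    refine WP.branch (fun hb => ?_) (fun hb => ?_)
    · simp only [Test.Holds, NatExp.eval, h4, hk7, e10] at hb
      refine WP.setNat ?_
      simp only [NatExp.eval, h4]
      refine ⟨by simpa [Memory.writeNat_nat] using h0, by simpa [Memory.writeNat_nat] using h4,
        (hE.write (by decide) _ _).write (by decide) _ _, fun x => ?_⟩
      have := hI x
      simp only [Memory.writeNat_nat]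
      grind
    · simp only [Test.Holds, NatExp.eval, h4, hk7, e10] at hb
      refine WP.skip ⟨h0, h4, hE.write (by decide) _ _, fun x => ?_⟩
      have := hI x
      simp only [Memory.writeNat_nat]
      grind
  · rintro m₁ h0 ⟨hE, hI⟩
    have e8 := hE.2 8 (by decide)
    have e9 := hE.2 9 (by decide)
    have e10 := hE.2 10 (by decide)
    have e11 := hE.2 11 (by decide)
    refine WP.seq (WP.setNat (WP.setNat ⟨?_, ?_, ?_⟩))
    · exact (((EqOff.refl [4, 7, 8] m).trans hE (by decide)).write
        (by decide) _ _).write (by decide) _ _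
    · intro x hx
      have := hI x
      simp only [Memory.writeNat_nat, NatExp.eval, e9, e10]
      grind
    · intro y hy
      simp only [Memory.writeNat_nat, NatExp.eval, e8, e10, e11]
      grind

end RealRAM

/-! ### Correctness of the auction, of the candidates and of the whole program -/

namespace RealRAM

/-- The auction has ended: unmatched vertices have only neighbours with the top label. -/
def AuctionDone (n : ℕ) (E : ℕ → ℕ → Prop) (p d : ℕ → ℕ) : Prop :=
  AuctionInv n E p d ∧ ∀ x y, E x y → p x = 0 → n + 2 ≤ d y

theorem WP.auction {B n : ℕ} (hB : n * (n + 2) + 1 ≤ B) {m : Memory} (hn : m.nat 0 0 = n) :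
    WP B auction (fun m' => EqOff [4, 5, 7, 8, 9, 10, 11] m m' ∧
      AuctionDone n (StoredEdge n m.real (m.nat 2 0) (m.nat 3 0)) (m'.nat 7) (m'.nat 8)) m := by
  have hB1 : n + 1 ≤ B := by nlinarith
  set E := StoredEdge n m.real (m.nat 2 0) (m.nat 3 0) with hE
  have hEn : ∀ x y, E x y → x < n ∧ y < n := fun x y h => ⟨h.1.1, h.2.1.1⟩
  refine WP.seq (WP.forLoop (n := n) (fun k m' => EqOff [4, 5, 7, 8, 9, 10, 11] m m' ∧
    ∀ x < k, m'.nat 7 x = 0 ∧ m'.nat 8 x = 0) (by omega) (by decide) hn ?_ ?_ ?_)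
  · exact ⟨(EqOff.refl _ _).write (by decide) _ _, fun x hx => absurd hx (Nat.not_lt_zero x)⟩
  · rintro k hk m₁ h0 h4 ⟨hq, hI⟩
    refine WP.seq (WP.setNat (WP.setNat ?_))
    simp only [NatExp.eval]
    refine ⟨by simpa [Memory.writeNat_nat] using h0, by simpa [Memory.writeNat_nat] using h4,
      ((hq.write (by decide) _ _).write (by decide) _ _).write (by decide) _ _, fun x hx => ?_⟩
    simp only [Memory.writeNat_nat, h4]
    grind
  · rintro m₁ h0 ⟨hq, hI⟩
    refine WP.seq (WP.setNat ?_)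
    -- The sum counts the label increments still possible and drops with each bid. The extra unit
    -- pays for the last round, which finds no bid. The bid label `0` written just before only
    -- serves to enter the loop.
    refine WP.loop (fun m' => EqOff [4, 5, 7, 8, 9, 10, 11] m m' ∧
      AuctionInv n E (m'.nat 7) (m'.nat 8) ∧ (m'.nat 11 0 ≤ n + 1 ∨
        ∀ x y, E x y → m'.nat 7 x = 0 → n + 2 ≤ m'.nat 8 y))
      (fun m' => ∑ y ∈ Finset.range n, (n + 2 - m'.nat 8 y) +
        if m'.nat 11 0 ≤ n + 1 then 1 else 0) ?_ ?_ ?_ ?_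
    · refine (Nat.add_le_add (Finset.sum_le_card_nsmul _ _ (n + 2) fun y _ => Nat.sub_le _ _)
        (?_ : _ ≤ 1)).trans ?_
      · split_ifs <;> omega
      · rw [Finset.card_range, smul_eq_mul]
        exact hB
    · refine ⟨hq.write (by decide) _ _, AuctionInv.init ?_ ?_, Or.inl ?_⟩
      · intro x hx
        rw [Memory.writeNat_nat_of_ne _ _ _ (by decide), (hI x hx).1]
      · intro x hx
        rw [Memory.writeNat_nat_of_ne _ _ _ (by decide), (hI x hx).2]
      · simp [NatExp.eval]
    · rintro m₂ ⟨hq2, hA, -⟩ hb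
      have h0 : m₂.nat 0 0 = n := by rw [hq2.2 0 (by decide), hn]
      have hb' : m₂.nat 11 0 ≤ n + 1 := by simpa [hasBid, Test.Holds, NatExp.eval, h0] using hb
      refine WP.seq ((WP.findBid hB1 h0).mono ?_)
      rintro m₃ ⟨hq3, c1, c2, c3⟩
      have h0 : m₃.nat 0 0 = n := by rw [hq3.2 0 (by decide), h0]
      have hq3' := hq2.trans hq3 (by decide)
      rw [hq3'.1, hq3'.2 2 (by decide), hq3'.2 3 (by decide), ← hE] at c1 c3
      have hA3 : AuctionInv n E (m₃.nat 7) (m₃.nat 8) := by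
        rw [hq3.2 7 (by decide), hq3.2 8 (by decide)]
        exact hA
      have hV : ∑ y ∈ Finset.range n, (n + 2 - m₃.nat 8 y) =
          ∑ y ∈ Finset.range n, (n + 2 - m₂.nat 8 y) := by rw [hq3.2 8 (by decide)]
      refine WP.branch (fun hb3 => ?_) (fun hb3 => ?_)
      · have hb3' : m₃.nat 11 0 ≤ n + 1 := by
          simpa [hasBid, Test.Holds, NatExp.eval, h0] using hb3
        obtain ⟨d1, d2, d3⟩ := c1 hb3'
        refine (WP.placeBid hB1 h0).mono ?_
        rintro m₄ ⟨hq4, e1, e2⟩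
        have h11 : m₄.nat 11 = m₃.nat 11 := hq4.2 11 (by decide)
        refine ⟨⟨hq3'.trans hq4 (by decide), hA3.bid hEn d1 d2 (by omega) ?_ e1 ?_, Or.inl ?_⟩, ?_⟩
        · intro y hy
          rcases c3 _ y trivial d2 hy with h | h <;> omega
        · rwa [d3]
        · rw [h11]; exact hb3'
        · rw [h11, if_pos hb3', if_pos hb', ← hV]
          exact Nat.add_lt_add_right (sum_label_bid (hEn _ _ d1).2 (by omega)
            (by rwa [d3])) _
      · have hb3' : ¬ m₃.nat 11 0 ≤ n + 1 := by
          simpa [hasBid, Test.Holds, NatExp.eval, h0] using hb3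
        refine WP.skip ⟨⟨hq3', hA3, Or.inr fun x y hxy hp => ?_⟩, ?_⟩
        · rcases c3 x y trivial hp hxy with h | h <;> omega
        · rw [hV, if_neg hb3', if_pos hb']
          omega
    · rintro m₂ ⟨hq2, hA, hs⟩ hb
      have h0 : m₂.nat 0 0 = n := by rw [hq2.2 0 (by decide), hn]
      have hb' : ¬ m₂.nat 11 0 ≤ n + 1 := by simpa [hasBid, Test.Holds, NatExp.eval, h0] using hb
      exact ⟨hq2, hA, hs.resolve_left hb'⟩

/-- The stored set is independent in the order of the segments, and its size is stored. -/
def BestInv (n : ℕ) (m : Memory) : Prop :=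
  ∃ C : Finset ℕ, (∀ i ∈ C, i < n) ∧ (∀ i ∈ C, ∀ j ∈ C, ¬ StoredLeftOf m.real i j) ∧
    m.nat 6 0 = C.card ∧ ∀ i < n, m.nat 1 i = if i ∈ C then 1 else 0

theorem BestInv.congr {n : ℕ} {m m' : Memory} (h : BestInv n m) (hr : m'.real = m.real)
    (h6 : m'.nat 6 = m.nat 6) (h1 : ∀ i < n, m'.nat 1 i = m.nat 1 i) : BestInv n m' := by
  obtain ⟨C, c1, c2, c3, c4⟩ := h
  exact ⟨C, c1, by rwa [hr], by rw [h6, c3], fun i hi => by rw [h1 i hi, c4 i hi]⟩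

open Classical in
theorem WP.collect {B n : ℕ} (hB : n + 1 ≤ B) {m : Memory} (hn : m.nat 0 0 = n)
    (hI : BestInv n m) {C : Finset ℕ}
    (hC : C = (Finset.range n).filter (LevelSet (StoredBetween m.real (m.nat 2 0) (m.nat 3 0))
      (m.nat 7) (m.nat 8) (m.nat 12 0 + 1)))
    (hind : ∀ i ∈ C, ∀ j ∈ C, ¬ StoredLeftOf m.real i j) :
    WP B collect (fun m' => EqOff [1, 4, 6, 13, 14] m m' ∧ BestInv n m' ∧
      m.nat 6 0 ≤ m'.nat 6 0 ∧ C.card ≤ m'.nat 6 0) m := by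
  refine WP.seq (WP.setNat (WP.seq ?_))
  have hCn : ∀ i ∈ C, i < n := fun i hi => by
    rw [hC] at hi
    exact Finset.mem_range.1 (Finset.mem_filter.1 hi).1
  have hCard : ∀ k < n, (C.filter (· < k + 1)).card =
      (C.filter (· < k)).card + if k ∈ C then 1 else 0 := by
    intro k _
    split_ifs with hk
    · rw [← Finset.card_insert_of_notMem (a := k) (by simp)]
      congr 1
      ext i
      simp only [Finset.mem_filter, Finset.mem_insert]
      constructor
      · rintro ⟨h1, h2⟩
        by_cases e : i = k
        · exact Or.inl e
        · exact Or.inr ⟨h1, by omega⟩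
      · rintro (rfl | ⟨h1, h2⟩)
        · exact ⟨hk, by omega⟩
        · exact ⟨h1, by omega⟩
    · congr 1
      ext i
      simp only [Finset.mem_filter]
      refine ⟨fun ⟨h1, h2⟩ => ⟨h1, ?_⟩, fun ⟨h1, h2⟩ => ⟨h1, by omega⟩⟩
      have : i ≠ k := fun e => hk (e ▸ h1)
      omega
  refine WP.forLoop (n := n) (fun k m' => EqOff [4, 13, 14] m m' ∧
    (∀ i < k, m'.nat 13 i = if i ∈ C then 1 else 0) ∧ m'.nat 14 0 = (C.filter (· < k)).card)
    (by omega) (by decide) (by simpa [Memory.writeNat_nat] using hn) ?_ ?_ ?_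
  · refine ⟨((EqOff.refl _ _).write (by decide) _ _).write (by decide) _ _,
      fun i hi => absurd hi (Nat.not_lt_zero i), ?_⟩
    simp [Memory.writeNat_nat, NatExp.eval]
  · rintro k hk m₁ h0 h4 ⟨hq, i1, i2⟩
    have hk' : k < n := hk
    have htest : levelTest.Holds m₁ ↔ k ∈ C := by
      simp only [levelTest, Test.Holds, betweenTest_holds, NatExp.eval, h4, hq.1,
        hq.2 2 (by decide), hq.2 3 (by decide), hq.2 7 (by decide), hq.2 8 (by decide),
        hq.2 12 (by decide), hC, Finset.mem_filter, Finset.mem_range, hk', true_and, LevelSet,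
        Nat.lt_succ_iff]
    have hc := hCard k hk'
    refine WP.branch (fun hb => ?_) (fun hb => ?_)
    · rw [htest] at hb
      rw [if_pos hb] at hc
      refine WP.seq (WP.setNat (WP.setNat ?_))
      simp only [NatExp.eval]
      refine ⟨by simpa [Memory.writeNat_nat] using h0, by simpa [Memory.writeNat_nat] using h4,
        ((hq.write (by decide) _ _).write (by decide) _ _).write (by decide) _ _,
        fun i hi => ?_, ?_⟩
      · have := i1 i
        simp only [Memory.writeNat_nat, h4]
        grind
      · rw [Memory.writeNat_nat_of_ne _ _ _ (by decide), hc, Memory.writeNat_nat_self,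
          Memory.writeNat_nat_of_ne _ _ _ (by decide), i2]
    · rw [htest] at hb
      rw [if_neg hb] at hc
      refine WP.setNat ?_
      simp only [NatExp.eval]
      refine ⟨by simpa [Memory.writeNat_nat] using h0, by simpa [Memory.writeNat_nat] using h4,
        (hq.write (by decide) _ _).write (by decide) _ _, fun i hi => ?_, ?_⟩
      · have := i1 i
        simp only [Memory.writeNat_nat, h4]
        grind
      · rw [Memory.writeNat_nat_of_ne _ _ _ (by decide), hc,
          Memory.writeNat_nat_of_ne _ _ _ (by decide), i2, Nat.add_zero]
  · rintro m₁ h0 ⟨hq, i1, i2⟩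
    have hall : (C.filter (· < n + 0)).card = C.card := by
      rw [Finset.filter_true_of_mem]
      exact hCn
    rw [hall] at i2
    have hq' : EqOff [1, 4, 6, 13, 14] m m₁ := (EqOff.refl _ m).trans hq (by decide)
    refine WP.branch (fun hb => ?_) (fun hb => ?_)
    · simp only [Test.Holds, NatExp.eval, i2] at hb
      exact WP.skip ⟨hq', hI.congr hq.1 (hq.2 6 (by decide)) fun i _ => by
        rw [hq.2 1 (by decide)], by rw [hq.2 6 (by decide)], hb⟩
    · simp only [Test.Holds, NatExp.eval, i2, hq.2 6 (by decide)] at hb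
      refine WP.seq (WP.setNat ?_)
      simp only [NatExp.eval, i2]
      refine WP.forLoop (n := n) (fun k m' => EqOff [1, 4, 6, 13, 14] m m' ∧
        (∀ i < n, m'.nat 13 i = if i ∈ C then 1 else 0) ∧ m'.nat 6 0 = C.card ∧
        (∀ i < k, m'.nat 1 i = if i ∈ C then 1 else 0))
        (by omega) (by decide) (by simpa [Memory.writeNat_nat] using h0) ?_ ?_ ?_
      · refine ⟨(hq'.write (by decide) _ _).write (by decide) _ _, ?_, ?_,
          fun i hi => absurd hi (Nat.not_lt_zero i)⟩
        · simpa [Memory.writeNat_nat] using i1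
        · simp [Memory.writeNat_nat]
      · rintro k hk m₂ h0 h4 ⟨hq, j1, j2, j3⟩
        refine WP.setNat ?_
        simp only [NatExp.eval, h4]
        refine ⟨by simpa [Memory.writeNat_nat] using h0, by simpa [Memory.writeNat_nat] using h4,
          (hq.write (by decide) _ _).write (by decide) _ _, ?_, ?_, fun i hi => ?_⟩
        · simpa [Memory.writeNat_nat] using j1
        · simpa [Memory.writeNat_nat] using j2
        · have := j3 i
          have := j1 k hk
          simp only [Memory.writeNat_nat]
          grind
      · rintro m₂ h0 ⟨hq, j1, j2, j3⟩
        exact ⟨hq, ⟨C, hCn, by rwa [hq.1], j2, j3⟩, by omega, j2.ge⟩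

/-- The order of the stored segments is transitive between any two of them. -/
def TransitiveBetween (n : ℕ) (ρ : ℕ → ℕ → ℝ) : Prop :=
  ∀ a < n, ∀ b < n, ∀ i < n, ∀ j < n, ∀ k < n, StoredBetween ρ a b i → StoredBetween ρ a b j →
    StoredBetween ρ a b k → StoredLeftOf ρ i j → StoredLeftOf ρ j k → StoredLeftOf ρ i k

/-- The stored set is at least as large as every independent set of segments between the `a`-th and
the `b`-th one. -/
def BestBetween (n : ℕ) (m : Memory) (a b : ℕ) : Prop :=
  ∀ Q : Finset ℕ, (∀ i ∈ Q, i < n ∧ StoredBetween m.real a b i) →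
    (∀ i ∈ Q, ∀ j ∈ Q, ¬ StoredLeftOf m.real i j) → Q.card ≤ m.nat 6 0

theorem BestBetween.congr {n : ℕ} {m m' : Memory} {a b : ℕ} (h : BestBetween n m a b)
    (hr : m'.real = m.real) (h6 : m.nat 6 0 ≤ m'.nat 6 0) : BestBetween n m' a b := by
  intro Q q1 q2
  rw [hr] at q1 q2
  exact (h Q q1 q2).trans h6

-- The candidate at every level is independent, so storing any of them is safe. One of the scanned
-- levels is empty and its candidate is maximum; the program need not know which.
open Classical in
theorem WP.collectLevels {B n : ℕ} (hB : n + 1 ≤ B) {m : Memory} (hn : m.nat 0 0 = n)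
    (ha : m.nat 2 0 < n) (hb : m.nat 3 0 < n) (htr : TransitiveBetween n m.real)
    (hI : BestInv n m)
    (hA : AuctionDone n (StoredEdge n m.real (m.nat 2 0) (m.nat 3 0)) (m.nat 7) (m.nat 8)) :
    WP B (RealRAM.forLoop 1 12 RealRAM.collect) (fun m' => EqOff [1, 4, 6, 12, 13, 14] m m' ∧
      BestInv n m' ∧ m.nat 6 0 ≤ m'.nat 6 0 ∧ BestBetween n m' (m.nat 2 0) (m.nat 3 0)) m := by
  set E := StoredEdge n m.real (m.nat 2 0) (m.nat 3 0) with hE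
  set C : ℕ → Finset ℕ := fun l => (Finset.range n).filter
    (LevelSet (StoredBetween m.real (m.nat 2 0) (m.nat 3 0)) (m.nat 7) (m.nat 8) (l + 1)) with hC
  have hind : ∀ l < n + 1, ∀ i ∈ C l, ∀ j ∈ C l, ¬ StoredLeftOf m.real i j := by
    intro l hl i hi j hj hij
    simp only [hC, Finset.mem_filter, Finset.mem_range] at hi hj
    exact hA.1.levelSet_independent hA.2 (l := l + 1) (by omega) hi.1 hi.2 hj.2
      ⟨⟨hi.1, hi.2.1⟩, ⟨hj.1, hj.2.1⟩, hij⟩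
  refine WP.forLoop (n := n) (fun k m' => EqOff [1, 4, 6, 12, 13, 14] m m' ∧ BestInv n m' ∧
    m.nat 6 0 ≤ m'.nat 6 0 ∧ ∀ l < k, (C l).card ≤ m'.nat 6 0) hB (by decide) hn ?_ ?_ ?_
  · refine ⟨(EqOff.refl _ _).write (by decide) _ _, hI.congr rfl ?_ fun i _ => ?_, ?_,
      fun l hl => absurd hl (Nat.not_lt_zero l)⟩
    · rw [Memory.writeNat_nat_of_ne _ _ _ (by decide)]
    · rw [Memory.writeNat_nat_of_ne _ _ _ (by decide)]
    · rw [Memory.writeNat_nat_of_ne _ _ _ (by decide)]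
  · rintro k hk m₁ h0 h12 ⟨hq, i1, i2, i3⟩
    refine (WP.collect hB h0 i1 (C := C k) ?_ ?_).mono ?_
    · rw [h12, hq.1, hq.2 2 (by decide), hq.2 3 (by decide), hq.2 7 (by decide),
        hq.2 8 (by decide)]
    · rw [hq.1]
      exact hind k hk
    · rintro m₂ ⟨hq2, j1, j2, j3⟩
      have w6 : (m₂.writeNat 12 0 (k + 1)).nat 6 = m₂.nat 6 :=
        Memory.writeNat_nat_of_ne _ _ _ (by decide)
      refine ⟨by rw [hq2.2 0 (by decide), h0], by rw [hq2.2 12 (by decide), h12],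
        (hq.trans hq2 (by decide)).write (by decide) _ _, j1.congr rfl w6 fun i _ => ?_, ?_, ?_⟩
      · rw [Memory.writeNat_nat_of_ne _ _ _ (by decide)]
      · rw [w6]; exact i2.trans j2
      · intro l hl
        rw [w6]
        by_cases e : l = k
        · rw [e]; exact j3
        · exact (i3 l (by omega)).trans j2
  · rintro m₁ h0 ⟨hq, i1, i2, i3⟩
    refine ⟨hq, i1, i2, fun Q q1 q2 => ?_⟩
    rw [hq.1] at q1 q2
    obtain ⟨l, hl, hle⟩ := exists_empty_level n (m.nat 8)
    exact (AuctionInv.card_le_card_levelSet (R := StoredLeftOf m.real)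
      (V := StoredBetween m.real (m.nat 2 0) (m.nat 3 0)) hA.1 hle (htr _ ha _ hb) q1 q2).trans
      (i3 l hl)

theorem WP.maxClique {B n : ℕ} (hB : n * (n + 2) + 1 ≤ B) {m : Memory} (hn : m.nat 0 0 = n)
    (htr : TransitiveBetween n m.real) (hI : BestInv n m) :
    WP B maxClique (fun m' => m'.real = m.real ∧ BestInv n m' ∧
      ∀ a < n, ∀ b < n, BestBetween n m' a b) m := by
  have hB1 : n + 1 ≤ B := by nlinarith
  refine WP.forLoop (n := n) (fun k m' => m'.real = m.real ∧ BestInv n m' ∧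
    ∀ a < k, ∀ b < n, BestBetween n m' a b) (by omega) (by decide) hn ?_ ?_ ?_
  · exact ⟨rfl, hI.congr rfl (Memory.writeNat_nat_of_ne _ _ _ (by decide)) fun i _ => by
      rw [Memory.writeNat_nat_of_ne _ _ _ (by decide)], fun a ha => absurd ha (Nat.not_lt_zero a)⟩
  · rintro k hk m₁ h0 h2 ⟨hr, hI, hbest⟩
    -- The stored size never decreases, so optimality for the pairs already treated persists.
    refine WP.forLoop (n := n) (fun l m' => m'.real = m.real ∧ m'.nat 2 0 = k ∧ BestInv n m' ∧
      ∀ a b, (a < k ∧ b < n) ∨ (a = k ∧ b < l) → BestBetween n m' a b)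
      (by omega) (by decide) h0 ?_ ?_ ?_
    · have w6 : (m₁.writeNat 3 0 0).nat 6 = m₁.nat 6 :=
        Memory.writeNat_nat_of_ne _ _ _ (by decide)
      refine ⟨hr, by rw [Memory.writeNat_nat_of_ne _ _ _ (by decide), h2], hI.congr rfl w6
        fun i _ => by rw [Memory.writeNat_nat_of_ne _ _ _ (by decide)], fun a b hab => ?_⟩
      exact (hbest a (by omega) b (by omega)).congr rfl (by rw [w6])
    · rintro l hl m₂ h0 h3 ⟨hr, h2, hI, hbest⟩
      refine WP.seq ((WP.auction hB h0).mono ?_)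
      rintro m₃ ⟨hq3, hA⟩
      have h0 : m₃.nat 0 0 = n := by rw [hq3.2 0 (by decide), h0]
      have h2 : m₃.nat 2 0 = k := by rw [hq3.2 2 (by decide), h2]
      have h3 : m₃.nat 3 0 = l := by rw [hq3.2 3 (by decide), h3]
      have hr3 : m₃.real = m.real := hq3.1.trans hr
      rw [← hq3.1, ← hq3.2 2 (by decide), ← hq3.2 3 (by decide)] at hA
      refine (WP.collectLevels hB1 h0 (by omega) (by omega) (by rwa [hr3])
        (hI.congr hq3.1 (hq3.2 6 (by decide)) fun i _ => by rw [hq3.2 1 (by decide)]) hA).mono ?_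
      rintro m₄ ⟨hq4, j1, j2, j3⟩
      rw [h2, h3] at j3
      rw [hq3.2 6 (by decide)] at j2
      have w6 : (m₄.writeNat 3 0 (l + 1)).nat 6 = m₄.nat 6 :=
        Memory.writeNat_nat_of_ne _ _ _ (by decide)
      refine ⟨by rw [hq4.2 0 (by decide), h0], by rw [hq4.2 3 (by decide), h3],
        hq4.1.trans hr3, ?_, j1.congr rfl w6 fun i _ => ?_, fun a b hab => ?_⟩
      · rw [Memory.writeNat_nat_of_ne _ _ _ (by decide), hq4.2 2 (by decide), h2]
      · rw [Memory.writeNat_nat_of_ne _ _ _ (by decide)]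
      · by_cases e : a = k ∧ b = l
        · rw [e.1, e.2]
          exact j3.congr rfl (by rw [w6])
        · exact (hbest a b (by omega)).congr (hq4.1.trans hq3.1) (by rwa [w6])
    · rintro m₂ h0 ⟨hr, h2, hI, hbest⟩
      have w6 : (m₂.writeNat 2 0 (k + 1)).nat 6 = m₂.nat 6 :=
        Memory.writeNat_nat_of_ne _ _ _ (by decide)
      refine ⟨h0, h2, hr, hI.congr rfl w6 fun i _ => ?_, fun a ha b hb => ?_⟩
      · rw [Memory.writeNat_nat_of_ne _ _ _ (by decide)]
      · exact (hbest a b (by omega)).congr rfl (by rw [w6])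
  · rintro m₁ h0 ⟨hr, hI, hbest⟩
    exact ⟨hr, hI, hbest⟩

end RealRAM

/-! ### Transfer from stored data to segments, and the polynomial time bound -/

namespace GroundedUnitSegment

variable {h : ℝ} {n : ℕ}

theorem storedLeftOf_inputMemory (S : Fin n → GroundedUnitSegment h) (i j : Fin n) :
    RealRAM.StoredLeftOf (inputMemory S).real i j ↔ (S i).LeftOf (S j) := by
  simp [RealRAM.StoredLeftOf, inputMemory, LeftOf, height]

theorem storedBetween_inputMemory (S : Fin n → GroundedUnitSegment h) (a b i : Fin n) :
    RealRAM.StoredBetween (inputMemory S).real a b i ↔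
      ((S a).ground 0 ≤ (S i).ground 0 ∧ (S i).ground 0 ≤ (S b).ground 0) ∧
        ¬ (S a).LeftOf (S i) ∧ ¬ (S i).LeftOf (S b) := by
  unfold RealRAM.StoredBetween
  rw [storedLeftOf_inputMemory, storedLeftOf_inputMemory]
  simp [inputMemory]

theorem transitiveBetween_inputMemory (S : Fin n → GroundedUnitSegment h) :
    RealRAM.TransitiveBetween n (inputMemory S).real := by
  intro a ha b hb i hi j hj k hk
  lift a to Fin n using ha
  lift b to Fin n using hb
  lift i to Fin n using hi
  lift j to Fin n using hj
  lift k to Fin n using hk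
  simp only [storedBetween_inputMemory, storedLeftOf_inputMemory]
  rintro ⟨⟨i1, -⟩, -, i4⟩ ⟨-, j3, j4⟩ ⟨⟨-, k2⟩, k3, -⟩ hij hjk
  exact hij.trans_of_not_leftOf hjk i1 k2 j3 k3 i4 j4

theorem isClique_iff_not_leftOf (S : Fin n → GroundedUnitSegment h) (C : Finset (Fin n)) :
    (intersectionGraph S).IsClique C ↔ ∀ i ∈ C, ∀ j ∈ C, ¬ (S i).LeftOf (S j) := by
  constructor
  · intro hC i hi j hj hij
    have hne : i ≠ j := fun e => (e ▸ hij).ground_lt.false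
    exact (hC hi hj hne).2.not_leftOf hij
  · intro hC i hi j hj hne
    exact ⟨hne, (meets_iff _ _).2 ⟨hC i hi j hj, hC j hj i hi⟩⟩

open RealRAM in
theorem maxClique_runs (S : Fin n → GroundedUnitSegment h) :
    WP ((n + 1) ^ 2) maxClique (fun m => ∃ C : Finset (Fin n),
      (intersectionGraph S).IsMaximumClique C ∧
        ∀ i : Fin n, m.nat 1 (i : ℕ) = if i ∈ C then 1 else 0) (inputMemory S) := by
  -- The square is exactly the bound `n * (n + 2) + 1` on the rounds of the auction. The zero-filled
  -- memory encodes the empty clique.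
  refine (WP.maxClique (n := n) (by ring_nf; omega) (by simp [inputMemory])
    (transitiveBetween_inputMemory S) ⟨∅, by simp, by simp, by simp [inputMemory],
      by simp [inputMemory]⟩).mono ?_
  rintro m ⟨hr, ⟨C, c1, c2, c3, c4⟩, hbest⟩
  rw [hr] at c2
  refine ⟨Finset.univ.filter (fun i : Fin n => (i : ℕ) ∈ C), ⟨?_, ?_⟩, ?_⟩
  · rw [isClique_iff_not_leftOf]
    intro i hi j hj hij
    exact c2 i (Finset.mem_filter.1 hi).2 j (Finset.mem_filter.1 hj).2
      ((storedLeftOf_inputMemory S i j).2 hij)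
  · intro Q hQ
    rw [isClique_iff_not_leftOf] at hQ
    have hcard : (Finset.univ.filter (fun i : Fin n => (i : ℕ) ∈ C)).card = C.card := by
      rw [← Finset.card_map Fin.valEmbedding]
      congr 1
      ext i
      simp only [Finset.mem_map, Finset.mem_filter, Finset.mem_univ, true_and,
        Fin.valEmbedding_apply]
      exact ⟨fun ⟨j, hj, e⟩ => e ▸ hj, fun hi => ⟨⟨i, c1 i hi⟩, hi, rfl⟩⟩
    rw [hcard, ← c3]
    rcases Q.eq_empty_or_nonempty with rfl | hne
    · simp
    -- The extreme members of the clique are one of the pairs tried, and all of `Q` lies between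
    -- them.
    obtain ⟨a, haQ, ha⟩ := Q.exists_min_image (fun i => (S i).ground 0) hne
    obtain ⟨b, hbQ, hb⟩ := Q.exists_max_image (fun i => (S i).ground 0) hne
    rw [← Finset.card_map Fin.valEmbedding]
    refine hbest a a.2 b b.2 _ ?_ ?_
    · intro i hi
      obtain ⟨i, hi', rfl⟩ := Finset.mem_map.1 hi
      rw [hr]
      exact ⟨i.2, (storedBetween_inputMemory S a b i).2
        ⟨⟨ha i hi', hb i hi'⟩, hQ a haQ i hi', hQ i hi' b hbQ⟩⟩
    · intro i hi j hj
      obtain ⟨i, hi', rfl⟩ := Finset.mem_map.1 hi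
      obtain ⟨j, hj', rfl⟩ := Finset.mem_map.1 hj
      rw [hr]
      exact fun hij => hQ i hi' j hj' ((storedLeftOf_inputMemory S i j).1 hij)
  · intro i
    rw [c4 i i.2]
    simp

theorem exists_program_maximumClique :
    ∃ (P : RealRAM.Prog) (q : Polynomial ℕ),
      ∀ (h : ℝ) (n : ℕ) (S : Fin n → GroundedUnitSegment h),
        ∃ (m : RealRAM.Memory) (t : ℕ),
          RealRAM.Runs P (GroundedUnitSegment.inputMemory S) m t ∧
          t ≤ q.eval n ∧
          ∃ C : Finset (Fin n),
            (GroundedUnitSegment.intersectionGraph S).IsMaximumClique C ∧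
            ∀ i : Fin n, m.nat 1 (i : ℕ) = if i ∈ C then 1 else 0 := by
  obtain ⟨q, hq⟩ := RealRAM.maxClique.exists_bound_eq_eval
  refine ⟨RealRAM.maxClique, q.comp ((Polynomial.X + 1) ^ 2), fun h n S => ?_⟩
  obtain ⟨m, t, h1, h2, h3⟩ := maxClique_runs S
  refine ⟨m, t, h1, ?_, h3⟩
  rw [Polynomial.eval_comp]
  simpa [hq] using h2

end GroundedUnitSegment
theorem theorem3 :
    (∃ (P : RealRAM.Prog) (q : Polynomial ℕ),
      ∀ (h : ℝ) (n : ℕ) (S : Fin n → GroundedUnitSegment h),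
        ∃ (m : RealRAM.Memory) (t : ℕ),
          RealRAM.Runs P (GroundedUnitSegment.inputMemory S) m t ∧
          t ≤ q.eval n ∧
          ∃ C : Finset (Fin n),
            (GroundedUnitSegment.intersectionGraph S).IsMaximumClique C ∧
            ∀ i : Fin n, m.nat 1 (i : ℕ) = if i ∈ C then 1 else 0) ∧
    (∀ (h : ℝ) (n : ℕ) (S : Fin n → GroundedUnitSegment h) (a b : Fin n),
      (GroundedUnitSegment.intersectionGraph S).Adj a b →
        (∀ r : GroundedUnitSegment.between S a b → GroundedUnitSegment.between S a b → Prop,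
          IsStrictTotalOrder (GroundedUnitSegment.between S a b) r →
          (∀ u v, r u v → (S u).ground 0 ≤ (S v).ground 0) →
          IsUmbrellaFreeOrdering
            ((GroundedUnitSegment.intersectionGraph S).induce
              (GroundedUnitSegment.between S a b)) r) ∧
        IsCocomparabilityGraph
          ((GroundedUnitSegment.intersectionGraph S).induce
            (GroundedUnitSegment.between S a b))) := by
  refine ⟨GroundedUnitSegment.exists_program_maximumClique, fun h n S a b _ => ⟨?_, ?_⟩⟩
  · exact fun r hr hg => GroundedUnitSegment.isUmbrellaFreeOrdering_between hr hg
  · exact GroundedUnitSegment.isCocomparabilityGraph_between
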